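/- Let $d\ge 1$, let $N$ and $\ell_1,\dots,\ell_{d+1}$ be nonnegative integers with $\ell_i\le N$ for all $i$ and $\ell_i+\ell_j\ge N$ for all $i\ne j$. Write $|\ell|=\ell_1+\cdots+\ell_{d+1}$, $\ell_{\min}=\min_i \ell_i$, $|x|=x_1+\cdots+x_d$ for a vector $x$ with $d$ entries, and $(a)_k=a(a+1)\cdots(a+k-1)$. Let $$V^d_{\ell,N}=\{x\in\mathbb N_0^d:\ x_i\le \ell_i\ (1\le i\le d),\ N-\ell_{d+1}\le |x|\le N\}.$$ For $\nu\in\mathbb N_0^d$ and $1\le j\le d$ put $\alpha_j=\alpha_j(\nu)=\sum_{i=j+1}^{d+1}\ell_i-2\sum_{i=j+1}^{d}\nu_i$ and $$H^d_{\ell,N}=\{\nu\in\mathbb N_0^d:\ |\nu|\le N,\ |\nu|\le|\ell|-N,\ \nu_j\le \ell_j,\ \nu_j\le\alpha_j\ (1\le j\le d)\}.$$ For $\nu\in H^d_{\ell,N}$ the Hahn polynomial for the hypergeometric distribution is $$Q_\nu(x;\ell,N)=\prod_{j=1}^d (-M_j)_{\nu_j}\;{}_3F_2\!\left(\begin{matrix}-\nu_j,\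 \nu_j-\ell_j-\alpha_j-1,\ -x_j\\ -\ell_j,\ -M_j\end{matrix};1\right),\qquad M_j=N-\sum_{i<j}x_i-\sum_{i>j}\nu_i ,$$ where ${}_3F_2$ is summed over $0\le k\le\nu_j$ and $(-M_j)_{\nu_j}/(-M_j)_k$ is read as the polynomial $(-M_j+k)_{\nu_j-k}$. Let $$B_\nu(\ell,N)=\frac{(-1)^{|\nu|}(-N)_{|\nu|}(-|\ell|)_{N+|\nu|}}{(-|\ell|)_N(-|\ell|)_{2|\nu|}}\prod_{j=1}^d\frac{(-\alpha_j)_{\nu_j}(-\ell_j-\alpha_j-1)_{2\nu_j}\,\nu_j!}{(-\ell_j)_{\nu_j}(-\ell_j-\alpha_j-1)_{\nu_j}},$$ and define the reproducing kernel of degree $n$ by $$P_n(H_{\ell,N};x,y)=\sum_{\nu\in H^d_{\ell,N},\ |\nu|=n}\frac{Q_\nu(x;\ell,N)\,Q_\nu(y;\ell,N)}{B_\nu(\ell,N)} .$$ For $x,y\in V^d_{\ell,N}$ let $X=(x,N-|x|)$, $Y=(y,N-|y|)$ and $$E_k(x,y;\ell)=\sum_{\substack{\gamma\in\mathbb N_0^{d+1},\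 |\gamma|=k\\ \gamma_i\le\ell_i}}\ \prod_{i=1}^{d+1}\frac{(-X_i)_{\gamma_i}(-Y_i)_{\gamma_i}}{(-\ell_i)_{\gamma_i}\,\gamma_i!}.$$ Then, for all $x,y\in V^d_{\ell,N}$ and all integers $0\le n\le\ell_{\min}$ (when $d=1$, assume also $n\le \ell_1+\ell_2-N$), $$P_n(H_{\ell,N};x,y)=\frac{(-N)_n\,(-|\ell|)_N\,(-|\ell|)_n\,(|\ell|+1-2n)}{n!\,(-|\ell|)_{N+n}\,(|\ell|+1-n)}\ \sum_{k=0}^n\frac{(-n)_k\,(n-1-|\ell|)_k}{(-N)_k\,(-N)_k}\,E_k(x,y;\ell).$$ -/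

import Mathlib

namespace HahnPolyhedra

open Finset

/-- The Pochhammer symbol `(a)_k = a (a + 1) ⋯ (a + k - 1)`. -/
noncomputable def poch (a : ℝ) (k : ℕ) : ℝ := (ascPochhammer ℝ k).eval a

/-- The one-variable Hahn polynomial with negative parameters,
`₃F₂(-n, n - a - b - 1, -x; -a, -M; 1)`, as a terminating series. -/
noncomputable def hahn (n : ℕ) (x a b M : ℝ) : ℝ :=
  ∑ k ∈ range (n + 1),
    poch (-n) k * poch (n - a - b - 1) k * poch (-x) k / (poch (-a) k * poch (-M) k * (k.factorial : ℝ))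

/-- The product `(-M)_n · ₃F₂(-n, n - a - b - 1, -x; -a, -M; 1)` as a polynomial in `x` and `M`:
the quotient `(-M)_n / (-M)_k`, `k ≤ n`, is the polynomial `(-M + k)_{n-k}`, so that the product has a
meaning also where `(-M)_n` vanishes (see `hahnCleared_eq`). -/
noncomputable def hahnCleared (n : ℕ) (x a b M : ℝ) : ℝ :=
  ∑ k ∈ range (n + 1),
    poch (-n) k * poch (n - a - b - 1) k * poch (-x) k / (poch (-a) k * (k.factorial : ℝ))
      * poch (-M + k) (n - k)

theorem poch_split (a : ℝ) {k n : ℕ} (h : k ≤ n) :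
    poch a n = poch a k * poch (a + k) (n - k) := by
  obtain ⟨m, rfl⟩ := Nat.exists_eq_add_of_le h
  simp [poch, ← ascPochhammer_mul]

theorem hahnCleared_eq (n : ℕ) (x a b M : ℝ) (h : poch (-M) n ≠ 0) :
    hahnCleared n x a b M = poch (-M) n * hahn n x a b M := by
  unfold hahnCleared hahn
  rw [mul_sum]
  refine sum_congr rfl fun k hk => ?_
  have hs := poch_split (-M) (Nat.lt_succ_iff.mp (mem_range.mp hk))
  have hk0 : poch (-M) k ≠ 0 := fun h0 => h (by rw [hs, h0, zero_mul])
  rw [hs, div_mul_eq_mul_div, mul_div_assoc', mul_right_comm (poch (-a) k),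
    mul_comm _ (poch (-M) k), mul_assoc (poch (-M) k), mul_div_mul_left _ _ hk0, mul_comm (poch _ (n - k))]

variable {d : ℕ}

/-- `|ν^{j+1}| = ν_{j+1} + ⋯ + ν_d`. -/
def tailSum (ν : Fin d → ℕ) (j : Fin d) : ℕ := ∑ i ∈ Ioi j, ν i

/-- `α_j = (ℓ_{j+1} + ⋯ + ℓ_{d+1}) - 2 (ν_{j+1} + ⋯ + ν_d)`, an integer that may be negative. -/
def alpha (ℓ : Fin (d + 1) → ℕ) (ν : Fin d → ℕ) (j : Fin d) : ℤ :=
  (∑ i ∈ Ioi j.castSucc, (ℓ i : ℤ)) - 2 * (tailSum ν j : ℤ)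

/-- The polyhedral lattice set
`{x ∈ ℕ^d : x_i ≤ ℓ_i for 1 ≤ i ≤ d, N - ℓ_{d+1} ≤ |x| ≤ N}`. -/
def polyhedron (ℓ : Fin (d + 1) → ℕ) (N : ℕ) : Set (Fin d → ℕ) :=
  {x | (∀ i : Fin d, x i ≤ ℓ i.castSucc) ∧
    (N : ℤ) - ℓ (Fin.last d) ≤ ∑ i, (x i : ℤ) ∧ ∑ i, x i ≤ N}

/-- The index set of the Hahn polynomials on the polyhedron. -/
def indexSet (ℓ : Fin (d + 1) → ℕ) (N : ℕ) : Set (Fin d → ℕ) :=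
  {ν | ∑ i, ν i ≤ N ∧ ((∑ i, ν i : ℕ) : ℤ) ≤ ((∑ i, ℓ i : ℕ) : ℤ) - N ∧
    ∀ j : Fin d, ν j ≤ ℓ j.castSucc ∧ (ν j : ℤ) ≤ alpha ℓ ν j}

/-- The Hahn polynomial in `d` variables with negative integer parameters: the product over `j` of
`(-M_j)_{ν_j} · ₃F₂(-ν_j, ν_j - ℓ_j - α_j - 1, -x_j; -ℓ_j, -M_j; 1)`, where
`M_j = N - (x_1 + ⋯ + x_{j-1}) - (ν_{j+1} + ⋯ + ν_d)`. -/
noncomputable def hahnMulti (ℓ : Fin (d + 1) → ℕ) (N : ℕ) (ν : Fin d → ℕ) (x : Fin d → ℝ) : ℝ :=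
  ∏ j : Fin d, hahnCleared (ν j) (x j) (ℓ j.castSucc) (alpha ℓ ν j)
    (N - (∑ i ∈ Iio j, x i) - tailSum ν j)

/-- The constant `B_ν(ℓ, N)`, the squared norm of the Hahn polynomial of index `ν`. -/
noncomputable def hahnNormSq (ℓ : Fin (d + 1) → ℕ) (N : ℕ) (ν : Fin d → ℕ) : ℝ :=
  (-1) ^ (∑ i, ν i) * poch (-N) (∑ i, ν i) * poch (-(∑ i, ℓ i : ℕ)) (N + ∑ i, ν i)
      / (poch (-(∑ i, ℓ i : ℕ)) N * poch (-(∑ i, ℓ i : ℕ)) (2 * ∑ i, ν i))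
    * ∏ j : Fin d,
      poch (-(alpha ℓ ν j)) (ν j) * poch (-(ℓ j.castSucc) - alpha ℓ ν j - 1) (2 * ν j)
          * ((ν j).factorial : ℝ)
        / (poch (-(ℓ j.castSucc)) (ν j) * poch (-(ℓ j.castSucc) - alpha ℓ ν j - 1) (ν j))

open Classical in
/-- The reproducing kernel of degree `n`: the sum of `Q_ν(x) Q_ν(y) / B_ν` over all `ν` in the
index set with `|ν| = n`. -/
noncomputable def kernel (ℓ : Fin (d + 1) → ℕ) (N n : ℕ) (x y : Fin d → ℝ) : ℝ :=
  ∑ ν ∈ (piAntidiag (univ : Finset (Fin d)) n).filter (fun ν => ν ∈ indexSet ℓ N),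
    hahnMulti ℓ N ν x * hahnMulti ℓ N ν y / hahnNormSq ℓ N ν

/-- Homogeneous coordinates `X = (x, N - |x|)`. -/
noncomputable def homog (N : ℕ) (x : Fin d → ℝ) : Fin (d + 1) → ℝ :=
  Fin.snoc (α := fun _ => ℝ) x (N - ∑ i, x i)

/-- `E_k(x, y; ℓ) = ∑ (-X)_γ (-Y)_γ / ((-ℓ)_γ γ!)` over `γ ∈ ℕ^{d+1}` with `|γ| = k`, `γ_i ≤ ℓ_i`. -/
noncomputable def elemE (ℓ : Fin (d + 1) → ℕ) (N k : ℕ) (x y : Fin d → ℝ) : ℝ :=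
  ∑ γ ∈ (piAntidiag (univ : Finset (Fin (d + 1))) k).filter (fun γ => ∀ i, γ i ≤ ℓ i),
    (∏ i, poch (-(homog N x i)) (γ i)) * (∏ i, poch (-(homog N y i)) (γ i))
      / ((∏ i, poch (-(ℓ i)) (γ i)) * ∏ i, ((γ i).factorial : ℝ))

/-- `ℓ_min = min {ℓ_1, …, ℓ_{d+1}}`. -/
def ellMin (ℓ : Fin (d + 1) → ℕ) : ℕ := univ.inf' univ_nonempty ℓ

end HahnPolyhedra

namespace HahnPolyhedra

open Finset

/-! ### Pochhammer symbols -/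

/-! The identity is proved by induction on the number of variables, splitting off the first one.
With `m` the degree in the remaining variables, the first factor of `Q_ν` and its weight depend on
those variables only through `m`, and the remaining factors form a kernel for the sample size `N -
x_1`. Since `x_1` and `y_1` differ, the induction needs two independent sample sizes; this is
`sum_realHahn_mul_realHahn`, stated in homogeneous coordinates with `∑ X` and `∑ Y` unrelated.
Comparing the coefficients of the sums `E_k` of the remaining variables leaves the one-variable
formula `sum_hahnCleared_mul_hahnCleared`.

That formula is the discrete form of a bilinear expansion of `₂F₁(-n, n-1-a-b; -a; st)` in products
of Jacobi polynomials `(1-t)^m ₂F₁(m-n, n+m-a-b-1; -a; t)`. The only property of `t^i (1-t)^k`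
needed is `t^i (1-t)^k = t^(i+1) (1-t)^k + t^i (1-t)^(k+1)`, so the monomials may be replaced by any
array with this Pascal relation; `hahnArray` is such an array and turns Jacobi into Hahn
polynomials. The expansion itself (`sum_jacobiWeight_mul_jacobiSum`) is checked on coefficients,
with one factor in powers of `1-s` and the other in the Bernstein basis; the sum over `m` is then a
divided difference on the quadratic lattice `m(m-b-1)`.

The recursion divides by Pochhammer symbols that may vanish at integers, so it is run for `ℓ_i + ε`,
and `ε → 0+` gives the integral case (`sum_realHahn_mul_realHahn_natCast`). Only the final identity
must be continuous there, and `n ≤ ℓ_min` ensures this. The same bound puts every `ν` of degree `n`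
in the index set. -/

theorem poch_zero (a : ℝ) : poch a 0 = 1 := by simp [poch]

theorem poch_succ (a : ℝ) (k : ℕ) : poch a (k + 1) = poch a k * (a + k) := by
  simp [poch, ascPochhammer_succ_right]

theorem poch_add (a : ℝ) (k m : ℕ) : poch a (k + m) = poch a k * poch (a + k) m := by
  simpa using poch_split a (Nat.le_add_right k m)

theorem poch_succ_left (a : ℝ) (k : ℕ) : poch a (k + 1) = a * poch (a + 1) k := by
  rw [add_comm k 1, poch_add, poch_succ, poch_zero]
  simp

theorem poch_ne_zero {a : ℝ} {k : ℕ} (h : ∀ i < k, a + i ≠ 0) : poch a k ≠ 0 := by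
  induction k with
  | zero => simp [poch_zero]
  | succ k ih =>
    rw [poch_succ]
    exact mul_ne_zero (ih fun i hi => h i (by omega)) (h k (by omega))

/-- A Pochhammer symbol with a non-integral base does not vanish. -/
theorem poch_ne_zero_of_not_int {a : ℝ} (h : ∀ z : ℤ, a ≠ z) (k : ℕ) : poch a k ≠ 0 :=
  poch_ne_zero fun i _ h0 => h (-i) (by push_cast; linarith)

theorem poch_neg_natCast (n k : ℕ) :
    poch (-(n : ℝ)) k = (-1) ^ k * (k.factorial : ℝ) * (n.choose k : ℝ) := by
  induction k with
  | zero => simp [poch_zero]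
  | succ k ih =>
    have h := congrArg (Nat.cast : ℕ → ℝ) (Nat.choose_succ_right_eq n k)
    rw [poch_succ, ih, Nat.factorial_succ]
    rcases le_or_gt k n with hk | hk
    · push_cast [Nat.cast_sub hk] at h ⊢
      linear_combination (-(-1) ^ k * (k.factorial : ℝ)) * (-h)
    · simp [Nat.choose_eq_zero_of_lt hk, Nat.choose_eq_zero_of_lt (Nat.lt_succ_of_lt hk)]

theorem poch_neg_natCast_ne_zero {n k : ℕ} (h : k ≤ n) : poch (-(n : ℝ)) k ≠ 0 :=
  poch_ne_zero fun i hi h0 => by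
    have : (i : ℝ) = n := by linarith
    have : i = n := by exact_mod_cast this
    omega

theorem poch_reflect (a : ℝ) (k : ℕ) : poch (1 - a - k) k = (-1) ^ k * poch a k := by
  induction k generalizing a with
  | zero => simp [poch_zero]
  | succ k ih =>
    rw [poch_succ_left, poch_succ]
    have := ih a
    push_cast
    rw [show 1 - a - ((k : ℝ) + 1) + 1 = 1 - a - k by ring, this]
    ring

/-! ### Summation lemmas for arrays with a Pascal-type relation -/

/-- A Pfaff transformation for arrays satisfying `g i j = g (i + 1) j + g i (j + 1)`. -/
theorem sum_pfaff (k : ℕ) (B C : ℝ) (g : ℕ → ℕ → ℝ) (hC : ∀ i < k, C + i ≠ 0)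
    (hg : ∀ i j, i + j < k → g i j = g (i + 1) j + g i (j + 1)) :
    ∑ i ∈ range (k + 1), (-1) ^ i * (k.choose i : ℝ) * poch B i / poch C i * g i 0 =
      ∑ i ∈ range (k + 1), (k.choose i : ℝ) * poch (C - B) i / poch C i * g i (k - i) := by
  induction k generalizing C g with
  | zero => simp [poch_zero]
  | succ k ih =>
    have pascal : ∀ u : ℕ → ℝ, ∑ i ∈ range (k + 1 + 1), ((k + 1).choose i : ℝ) * u i =
        ∑ i ∈ range (k + 1), (k.choose i : ℝ) * (u i + u (i + 1)) := by
      intro u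
      rw [sum_range_succ']
      simp only [Nat.choose_succ_succ, Nat.cast_add, add_mul, mul_add, sum_add_distrib,
        Nat.choose_zero_right, Nat.succ_eq_add_one, Nat.cast_one]
      have h1 := sum_range_succ' (fun i => (k.choose i : ℝ) * u i) (k + 1)
      rw [sum_range_succ] at h1
      simp at h1
      linarith
    have hC0 : C ≠ 0 := by simpa using hC 0 (by omega)
    -- Reading `g i j` as `t^i (1-t)^j`, the factor `1 - t` keeps `C` and the factor `t` raises it
    -- to `C + 1`. The two Pascal relations leave `1 - (B+i)/(C+i)` on the second part, which gives
    -- the constant `(C - B)/C`.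
    have e1 := ih C (fun i j => g i (j + 1)) (fun i hi => hC i (by omega))
      (fun i j h => hg i (j + 1) (by omega))
    have e2 := ih (C + 1) (fun i j => g (i + 1) j)
      (fun i hi => by have := hC (i + 1) (by omega); push_cast at this; rwa [add_assoc, add_comm 1])
      (fun i j h => hg (i + 1) j (by omega))
    have l := pascal fun i => (-1) ^ i * poch B i / poch C i * g i 0
    have r := pascal fun i => poch (C - B) i / poch C i * g i (k + 1 - i)
    calc _ = ∑ i ∈ range (k + 1 + 1), ((k + 1).choose i : ℝ) *
            ((-1) ^ i * poch B i / poch C i * g i 0) := sum_congr rfl fun i _ => by ring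
      _ = ∑ i ∈ range (k + 1), ((-1) ^ i * (k.choose i : ℝ) * poch B i / poch C i * g i 1) +
          (C - B) / C * ∑ i ∈ range (k + 1),
            ((-1) ^ i * (k.choose i : ℝ) * poch B i / poch (C + 1) i * g (i + 1) 0) := by
        rw [l, mul_sum, ← sum_add_distrib]
        refine sum_congr rfl fun i hi => ?_
        have hi' : i ≤ k := by simpa [Nat.lt_succ_iff] using hi
        have n1 : poch C i ≠ 0 := poch_ne_zero fun j hj => hC j (by omega)
        have n2 : C + i ≠ 0 := hC i (by omega)
        have s : poch C (i + 1) = C * poch (C + 1) i := poch_succ_left C i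
        rw [poch_succ C i] at s
        have n3 : poch (C + 1) i ≠ 0 := by
          intro h; rw [h, mul_zero] at s; exact mul_ne_zero n1 n2 s
        rw [poch_succ B, poch_succ C, hg i 0 (by omega), s, pow_succ]
        field_simp
        linear_combination (-(k.choose i : ℝ) * poch B i * g (i + 1) 0) * s
      _ = _ := by
        rw [e1, e2, mul_sum, ← sum_add_distrib]
        have : ∀ i, ((k + 1).choose i : ℝ) * poch (C - B) i / poch C i * g i (k + 1 - i) =
          ((k + 1).choose i : ℝ) * (poch (C - B) i / poch C i * g i (k + 1 - i)) := fun i => by ring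
        simp only [this]
        rw [r]
        refine sum_congr rfl fun i hi => ?_
        have hi' : i ≤ k := by simpa [Nat.lt_succ_iff] using hi
        rw [show k + 1 - (i + 1) = k - i by omega, show k - i + 1 = k + 1 - i by omega,
          poch_succ_left (C - B), poch_succ_left C, show C - B + 1 = C + 1 - B by ring,
          mul_div_mul_comm]
        ring

/-- A Gauss-type connection formula for arrays satisfying `g i j = g (i + 1) j + g i (j + 1)`. -/
theorem sum_gauss (k : ℕ) (B C : ℝ) (g : ℕ → ℕ → ℝ) (hC : ∀ i < k, C + i ≠ 0)
    (hD : ∀ i < k, 1 + B - C - k + i ≠ 0)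
    (hg : ∀ i j, i + j < k → g i j = g (i + 1) j + g i (j + 1)) :
    ∑ i ∈ range (k + 1), (-1) ^ i * (k.choose i : ℝ) * poch B i / poch C i * g i 0 =
      poch (C - B) k / poch C k * ∑ i ∈ range (k + 1),
        (-1) ^ i * (k.choose i : ℝ) * poch B i / poch (1 + B - C - k) i * g 0 i := by
  -- Both sides are brought to the diagonal `i + j = k`, the right one through the transposed array,
  -- which exchanges `t` and `1 - t`.
  rw [sum_pfaff k B C g hC hg, sum_pfaff k B (1 + B - C - k) (fun i j => g j i) hD
    (fun i j h => by rw [hg j i (by omega), add_comm]), ← sum_range_reflect, mul_sum]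
  refine sum_congr rfl fun i hi => ?_
  obtain ⟨t, rfl⟩ : ∃ t, k = i + t := ⟨k - i, by simp at hi; omega⟩
  rw [show i + t + 1 - 1 - i = t by omega, show i + t - t = i by omega,
    show i + t - i = t by omega, Nat.choose_symm_add]
  have h1 := poch_reflect (C + t) i
  have h2 := poch_reflect (C - B + t) i
  have n1 : poch C (t + i) ≠ 0 := poch_ne_zero fun j hj => hC j (by omega)
  have n2 : poch (1 + B - C - (i + t : ℕ)) i ≠ 0 := poch_ne_zero fun j hj => hD j (by omega)
  rw [add_comm i t] at *
  rw [show 1 + B - C - ((t + i : ℕ) : ℝ) - B = 1 - (C + t) - i by push_cast; ring, h1]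
  rw [show 1 + B - C - ((t + i : ℕ) : ℝ) = 1 - (C - B + t) - i by push_cast; ring, h2] at *
  rw [poch_add] at n1
  have n3 := right_ne_zero_of_mul n2
  have n4 := left_ne_zero_of_mul n1
  have n5 := right_ne_zero_of_mul n1
  have n6 : ((-1 : ℝ)) ^ i ≠ 0 := by simp
  rw [poch_add, poch_add]
  field_simp

/-- This is `t^r = (1 - (1 - t))^r`: in the Pfaff transformation with `B = C` only the term with
`(0)_0` survives. -/
theorem sum_binomial_inversion (r : ℕ) (g : ℕ → ℕ → ℝ)
    (hg : ∀ i j, i + j < r → g i j = g (i + 1) j + g i (j + 1)) :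
    g r 0 = ∑ q ∈ range (r + 1), (-1) ^ q * (r.choose q : ℝ) * g 0 q := by
  have h := sum_pfaff r 1 1 (fun i j => g j i)
    (fun i _ => by positivity) (fun i j h => by rw [hg j i (by omega), add_comm])
  have h0 : ∀ i, poch (0 : ℝ) (i + 1) = 0 := fun i => by rw [poch_succ_left, zero_mul]
  have h1 : ∀ i, poch (1 : ℝ) i ≠ 0 := fun i => poch_ne_zero fun j _ => by positivity
  rw [sum_congr rfl fun i _ => show (-1) ^ i * (r.choose i : ℝ) * g 0 i =
    (-1) ^ i * (r.choose i : ℝ) * poch 1 i / poch 1 i * g 0 i by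
      rw [mul_div_assoc, div_self (h1 i), mul_one], h, sum_range_succ']
  simp [h0, poch_zero]

/-! ### Newton expansion and divided differences on a quadratic lattice -/

/-- Expansion of `(m - n)_j (b + 1 - n - m)_j` in the basis `(-m)_q (m - b - 1)_q`. -/
theorem poch_mul_poch_expansion (j : ℕ) (n m b : ℝ) :
    poch (m - n) j * poch (b + 1 - n - m) j =
      ∑ q ∈ range (j + 1), (j.choose q : ℝ) * poch (q - n) (j - q) * poch (b + 1 - n) (j - q) *
        (poch (-m) q * poch (m - b - 1) q) := by
  obtain ⟨N, hN⟩ : ∃ N : ℕ → ℝ, ∀ q, N q = poch (-m) q * poch (m - b - 1) q := ⟨_, fun _ => rfl⟩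
  have hN1 : ∀ q, N (q + 1) = N q * ((-m + q) * (m - b - 1 + q)) := fun q => by
    rw [hN, hN, poch_succ, poch_succ]
    ring
  have hN0 : N 0 = 1 := by simp [hN, poch_zero]
  simp only [← hN]
  induction j with
  | zero => simp [poch_zero, hN0]
  | succ j ih =>
    obtain ⟨s, hs⟩ : ∃ s : ℕ → ℕ → ℝ, ∀ j q, s j q =
      (j.choose q : ℝ) * poch (q - n) (j - q) * poch (b + 1 - n) (j - q) := ⟨_, fun _ _ => rfl⟩
    simp only [← hs] at ih ⊢
    rw [poch_succ, poch_succ, show poch (m - n) j * (m - n + j) * (poch (b + 1 - n - m) j *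
      (b + 1 - n - m + j)) = (poch (m - n) j * poch (b + 1 - n - m) j) *
        ((m - n + j) * (b + 1 - n - m + j)) by ring, ih, sum_mul]
    -- The new quadratic factor differs from the next Newton factor `(-m + q)(m - b - 1 + q)` by a
    -- constant in `m`, because both depend on `m` only through `m(m - b - 1)`.
    have split : ∀ q ∈ range (j + 1), s j q * N q * ((m - n + j) * (b + 1 - n - m + j)) =
        s j q * N (q + 1) + s j q * ((n - j - q) * (n - j + q - b - 1)) * N q := by
      intro q _
      rw [hN1]
      ring
    have mid : ∀ q ∈ range j, s (j + 1) (q + 1) * N (q + 1) = s j q * N (q + 1) +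
        s j (q + 1) * ((n - j - (q + 1 : ℕ)) * (n - j + (q + 1 : ℕ) - b - 1)) * N (q + 1) := by
      intro q hq
      obtain ⟨t, rfl⟩ : ∃ t, j = q + 1 + t := ⟨j - (q + 1), by simp at hq; omega⟩
      have h := congrArg (Nat.cast : ℕ → ℝ) (Nat.choose_succ_right_eq (q + 1 + t) q)
      rw [show q + 1 + t - q = t + 1 by omega] at h
      rw [hs, hs, hs, show q + 1 + t + 1 - (q + 1) = t + 1 by omega,
        show q + 1 + t - q = t + 1 by omega,
        show q + 1 + t - (q + 1) = t by omega, Nat.choose_succ_succ' (q + 1 + t) q,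
        poch_succ_left ((q : ℝ) - n), poch_succ ((q + 1 : ℕ) - n : ℝ), poch_succ (b + 1 - n)]
      push_cast at h ⊢
      rw [show (q : ℝ) - n + 1 = q + 1 - n by ring]
      linear_combination (-(poch (q + 1 - n) t * poch (b + 1 - n) t * N (q + 1)) *
        (b + 1 - n + t)) * h
    have last : s (j + 1) (j + 1) = s j j := by simp [hs, poch_zero]
    have first : s (j + 1) 0 = s j 0 * ((n - j) * (n - j - b - 1)) := by
      rw [hs, hs]
      simp [poch_succ]
      ring
    rw [sum_congr rfl split, sum_add_distrib, sum_range_succ (fun q => s (j + 1) q * N q),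
      sum_range_succ' (fun q => s (j + 1) q * N q), sum_congr rfl mid, sum_add_distrib,
      sum_range_succ (fun q => s j q * N (q + 1)),
      sum_range_succ' (fun q => s j q * ((n - j - q) * (n - j + q - b - 1)) * N q), last, first]
    push_cast
    ring

/-- A telescoping alternating sum. -/
theorem sum_alternating_telescope (Q s : ℕ) (c : ℝ) (hc : ∀ i : ℕ, c + i ≠ 0) :
    ∑ t ∈ range (s + 1), (-1) ^ t * ((Q + 1).choose t : ℝ) * (c + 2 * t) / poch (c + t) (Q + 2) =
      (-1) ^ s * (Q.choose s : ℝ) / poch (c + s + 1) (Q + 1) := by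
  have hp : ∀ (i : ℕ) (k : ℕ), poch (c + i) k ≠ 0 := fun i k =>
    poch_ne_zero fun j _ => by
      have := hc (i + j); push_cast at this; rwa [add_assoc]
  induction s with
  | zero =>
    have := hp 1 (Q + 1)
    have h0 := hc 0
    simp only [Nat.cast_zero, Nat.cast_one, add_zero] at *
    simp [poch_succ_left c (Q + 1)]
    field_simp
  | succ s ih =>
    rw [sum_range_succ, ih]
    have h := congrArg (Nat.cast : ℕ → ℝ) (Nat.choose_succ_right_eq Q s)
    have h' : (Q.choose (s + 1) : ℝ) * (s + 1) = (Q.choose s : ℝ) * (Q - s) := by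
      rcases le_or_gt s Q with hs | hs
      · push_cast [Nat.cast_sub hs] at h; exact h
      · simp [Nat.choose_eq_zero_of_lt hs, Nat.choose_eq_zero_of_lt (Nat.lt_succ_of_lt hs)]
    have n1 := hp (s + 1) (Q + 1)
    have n2 := hp (s + 2) (Q + 1)
    have n3 := hc (s + 1)
    have n4 := hc (s + 1 + (Q + 1))
    have s1 := poch_succ_left (c + (s + 1 : ℕ)) (Q + 1)
    have s2 := poch_succ (c + (s + 1 : ℕ)) (Q + 1)
    rw [s2] at s1
    rw [poch_succ _ (Q + 1), Nat.choose_succ_succ']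
    push_cast at *
    rw [show c + (s + 1) + 1 = c + (s + 2 : ℝ) by ring] at *
    rw [show c + s + 1 = c + ((s : ℝ) + 1) by ring]
    rw [show c + ((s : ℝ) + 1 + (Q + 1)) = c + (s + 1) + (Q + 1) by ring] at n4
    rw [div_add_div _ _ n1 (mul_ne_zero n1 n4), div_eq_div_iff (mul_ne_zero n1 (mul_ne_zero n1 n4)) n2]
    generalize poch (c + (s + 1)) (Q + 1) = u at *
    generalize poch (c + (s + 2)) (Q + 1) = v at *
    rw [pow_succ]
    linear_combination (-1) ^ s * u * v * -h' + (-1) ^ s * (Q.choose (s + 1) : ℝ) * u * s1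

/-- Inversion relation for the weights `1 / ((m - b - 1)_m (2 m - b)_{q - m})`. -/
theorem sum_newton_orthogonality (p q : ℕ) (b : ℝ) (hb : ∀ z : ℤ, b ≠ z) :
    ∑ m ∈ range (q + 1), (-1) ^ (q - m) * (q.choose m : ℝ) /
        (poch (m - b - 1) m * poch (2 * m - b) (q - m)) * (poch (-(m : ℝ)) p * poch (m - b - 1) p) =
      if p = q then (-1) ^ q * (q.factorial : ℝ) else 0 := by
  have nz : ∀ (z : ℤ) (k : ℕ), poch (z - b) k ≠ 0 := fun z k =>
    poch_ne_zero_of_not_int (fun w h => hb (z - w) (by push_cast; linarith)) k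
  -- With nodes `λ_i = i(i - b - 1)` one has `λ_m - λ_i = (m - i)(m + i - b - 1)`. The weights are
  -- therefore `q!` times those of the divided difference at `λ_0, …, λ_q`, applied to `(-1)^p
  -- ∏_{i<p} (λ - λ_i)`. It vanishes at all nodes for `p > q` and has degree below `q` for `p < q`.
  rcases lt_or_ge q p with hpq | hpq
  · rw [if_neg (by omega)]
    refine sum_eq_zero fun m hm => ?_
    rw [poch_neg_natCast m, Nat.choose_eq_zero_of_lt (show m < p by simp at hm; omega)]
    simp
  · obtain ⟨r, rfl⟩ := Nat.exists_eq_add_of_le hpq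
    have hz : ∑ m ∈ range p, (-1) ^ (p + r - m) * ((p + r).choose m : ℝ) /
        (poch (m - b - 1) m * poch (2 * m - b) (p + r - m)) *
          (poch (-(m : ℝ)) p * poch (m - b - 1) p) = 0 := by
      refine sum_eq_zero fun m hm => ?_
      rw [poch_neg_natCast m, Nat.choose_eq_zero_of_lt (show m < p by simpa using hm)]
      simp
    rw [add_assoc p r 1, sum_range_add, hz, zero_add]
    have term : ∀ t ∈ range (r + 1), (-1) ^ (p + r - (p + t)) * ((p + r).choose (p + t) : ℝ) /
        (poch ((p + t : ℕ) - b - 1) (p + t) * poch (2 * (p + t : ℕ) - b) (p + r - (p + t))) *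
          (poch (-((p + t : ℕ) : ℝ)) p * poch ((p + t : ℕ) - b - 1) p) =
        (-1) ^ (p + r) * (p.factorial : ℝ) * ((p + r).choose p : ℝ) *
        ((-1) ^ t * (r.choose t : ℝ) * ((2 * p - b - 1) + 2 * t) /
          poch ((2 * p - b - 1) + t) (r + 1)) := by
      intro t ht
      obtain ⟨u, rfl⟩ : ∃ u, r = t + u := ⟨r - t, by simp at ht; omega⟩
      have hch := Nat.choose_mul (n := p + (t + u)) (k := p + t) (s := p) (by omega)
      rw [show p + (t + u) - p = t + u by omega, show p + t - p = t by omega] at hch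
      have hch' := congrArg (Nat.cast : ℕ → ℝ) hch
      push_cast at hch'
      rw [poch_neg_natCast, show p + (t + u) - (p + t) = u by omega, poch_add _ p t,
        show t + u + 1 = t + (1 + u) by omega, poch_add _ t (1 + u), poch_add _ 1 u,
        poch_succ _ 0, poch_zero]
      have e1 : ((p + t : ℕ) : ℝ) - b - 1 + p = 2 * p - b - 1 + t := by push_cast; ring
      have e2 : 2 * (p : ℝ) - b - 1 + t + t + (1 : ℕ) = 2 * (p + t : ℕ) - b := by push_cast; ring
      rw [e1, e2]
      have n1 := nz (p + t - 1 : ℤ) p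
      have n2 := nz (2 * p - 1 + t : ℤ) t
      have n3 := nz (2 * p + 2 * t : ℤ) u
      have n4 := nz (2 * p + 2 * t - 1 : ℤ) 1
      rw [poch_succ, poch_zero] at n4
      push_cast at n1 n2 n3 n4 ⊢
      rw [show (p : ℝ) + t - b - 1 = p + t - 1 - b by ring,
        show 2 * (p : ℝ) - b - 1 + t = 2 * p - 1 + t - b by ring,
        show 2 * (p + t : ℝ) - b = 2 * p + 2 * t - b by ring]
      have n5' : 2 * (p : ℝ) - b - 1 + 2 * t ≠ 0 := by
        intro h; apply n4; rw [one_mul]; linarith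
      have sg : (-1 : ℝ) ^ (p + (t + u)) = (-1) ^ u * (-1) ^ p * (-1) ^ t := by ring
      have sg2 : (-1 : ℝ) ^ t * (-1) ^ t = 1 := by rw [← mul_pow]; simp
      rw [show 2 * (p : ℝ) - 1 + t - b + t + 0 = 2 * p - b - 1 + 2 * t by ring, sg]
      generalize poch ((p : ℝ) + t - 1 - b) p = w1 at *
      generalize poch (2 * (p : ℝ) - 1 + t - b) t = w2 at *
      generalize poch (2 * (p : ℝ) + 2 * t - b) u = w3 at *
      generalize 2 * (p : ℝ) - b - 1 + 2 * t = w4 at *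
      field_simp
      linear_combination hch' - ((p + (t + u)).choose p : ℝ) * ((t + u).choose t : ℝ) * sg2
    rw [sum_congr rfl term, ← mul_sum]
    have hc : ∀ i : ℕ, 2 * (p : ℝ) - b - 1 + i ≠ 0 := fun i h =>
      hb (2 * p - 1 + i) (by push_cast; linarith)
    cases r with
    | zero =>
      have := hc 0
      rw [if_pos (by omega)]
      simp [poch_succ, poch_zero] at *
      rw [div_self this, mul_one]
    | succ r =>
      -- The full sum has one term more than the binomial in the closed form allows, so it carries
      -- the factor `r.choose (r + 1) = 0`.
      rw [if_neg (by omega), sum_alternating_telescope r (r + 1) _ hc]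
      simp

/-! ### Jacobi polynomials and their bilinear expansion -/

/-- The weights of the bilinear expansion `sum_jacobiWeight_mul_jacobiSum`. -/
noncomputable def jacobiWeight (n : ℕ) (a b : ℝ) (m : ℕ) : ℝ :=
  (-1) ^ (n - m) * (n.choose m : ℝ) * poch (-a) (n - m) * poch (n - a - b - 1) m *
    (2 * m - b - 1) / poch (m - b - 1) (n + 1)

/-- The Jacobi polynomial `(1 - t) ^ m * ₂F₁(m - n, n + m - a - b - 1; -a; t)` with
`t ^ i * (1 - t) ^ k` replaced by `e i k`. -/
noncomputable def jacobiSum (n : ℕ) (a b : ℝ) (m : ℕ) (e : ℕ → ℕ → ℝ) : ℝ :=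
  ∑ i ∈ range (n - m + 1), (-1) ^ i * ((n - m).choose i : ℝ) * poch (n + m - a - b - 1) i /
    poch (-a) i * e i m

/-- The Pfaff transformation gives the Bernstein form. The range is extended past `n - m` by zero
binomials so that it no longer depends on `m`. -/
theorem jacobiSum_eq_sum_diag {n m : ℕ} (hm : m ≤ n) {a : ℝ} (ha : ∀ z : ℤ, a ≠ z) (b : ℝ)
    (e : ℕ → ℕ → ℝ) (he : ∀ i k, i + k < n → e i k = e (i + 1) k + e i (k + 1)) :
    jacobiSum n a b m e = ∑ j ∈ range (n + 1),
      ((n - m).choose j : ℝ) * poch (b + 1 - n - m) j / poch (-a) j * e j (n - j) := by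
  obtain ⟨k, rfl⟩ := Nat.exists_eq_add_of_le hm
  have h := sum_pfaff k ((m + k : ℕ) + m - a - b - 1) (-a) (fun i j => e i (m + j))
    (fun i _ h => ha i (by push_cast; linarith)) (fun i j h => he i (m + j) (by omega))
  simp only [jacobiSum, add_zero, Nat.add_sub_cancel_left] at h ⊢
  rw [h, show m + k + 1 = k + 1 + m by omega, sum_range_add _ (k + 1) m]
  have z : ∑ x ∈ range m, (k.choose (k + 1 + x) : ℝ) * poch (b + 1 - (m + k : ℕ) - m) (k + 1 + x) /
      poch (-a) (k + 1 + x) * e (k + 1 + x) (m + k - (k + 1 + x)) = 0 :=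
    sum_eq_zero fun x _ => by rw [Nat.choose_eq_zero_of_lt (by omega)]; simp
  rw [z, add_zero]
  refine sum_congr rfl fun i hi => ?_
  rw [show m + (k - i) = m + k - i by simp at hi; omega,
    show -a - (((m + k : ℕ) : ℝ) + m - a - b - 1) = b + 1 - (m + k : ℕ) - m by ring]

/-- The Gauss formula re-expands the polynomial in powers of `1 - t`. The factor `jacobiWeight` is
such that the dependence on `m` is exactly the divided-difference weight of
`sum_newton_orthogonality`. -/
theorem jacobiWeight_mul_jacobiSum {n m : ℕ} (hm : m ≤ n) {a b : ℝ} (ha : ∀ z : ℤ, a ≠ z)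
    (hb : ∀ z : ℤ, b ≠ z) (e : ℕ → ℕ → ℝ)
    (he : ∀ i k, i + k < n → e i k = e (i + 1) k + e i (k + 1)) :
    jacobiWeight n a b m * jacobiSum n a b m e = ∑ q ∈ range (n + 1),
      (n.choose q : ℝ) * poch (n - a - b - 1) q * ((-1) ^ (q - m) * (q.choose m : ℝ) /
        (poch (m - b - 1) m * poch (2 * m - b) (q - m))) * e 0 q := by
  obtain ⟨k, rfl⟩ := Nat.exists_eq_add_of_le hm
  have nz : ∀ (z : ℤ) (k : ℕ), poch (z - b) k ≠ 0 := fun z k =>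
    poch_ne_zero_of_not_int (fun w h => hb (z - w) (by push_cast; linarith)) k
  have nza : ∀ k : ℕ, poch (-a) k ≠ 0 := fun k =>
    poch_ne_zero_of_not_int (fun w h => ha (-w) (by push_cast; linarith)) k
  have hC' : 1 + (((m + k : ℕ) : ℝ) + m - a - b - 1) - -a - k = 2 * m - b := by push_cast; ring
  have h := sum_gauss k ((m + k : ℕ) + m - a - b - 1) (-a) (fun i j => e i (m + j))
    (fun i _ h => ha i (by push_cast; linarith))
    (fun i _ h => by
      rw [hC'] at h
      exact hb (2 * m + i) (by push_cast; linarith))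
    (fun i j h => he i (m + j) (by omega))
  rw [hC'] at h
  simp only [jacobiSum, add_zero, Nat.add_sub_cancel_left] at h ⊢
  rw [h, add_assoc m k 1, sum_range_add _ m (k + 1)]
  have z : ∑ q ∈ range m, ((m + k).choose q : ℝ) * poch ((m + k : ℕ) - a - b - 1) q *
      ((-1) ^ (q - m) * (q.choose m : ℝ) /
        (poch (m - b - 1) m * poch (2 * m - b) (q - m))) * e 0 q = 0 :=
    sum_eq_zero fun x hx => by
      rw [Nat.choose_eq_zero_of_lt (n := x) (by simpa using hx)]; simp
  rw [z, zero_add, ← mul_assoc, mul_sum]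
  refine sum_congr rfl fun t ht => ?_
  have ht' : t ≤ k := by simp at ht; omega
  have hch := Nat.choose_mul (n := m + k) (k := m + t) (s := m) (by omega)
  rw [show m + k - m = k by omega, show m + t - m = t by omega] at hch
  have hch' := congrArg (Nat.cast : ℕ → ℝ) hch
  push_cast at hch'
  have hrefl := poch_reflect (2 * m - b) k
  have n1 := nz (m - 1 : ℤ) m
  have n2 := nz (2 * m : ℤ) k
  have n3 := nz (2 * m - 1 : ℤ) 1
  have n4 := nz (2 * m : ℤ) t
  have n5 := nza k
  rw [poch_succ, poch_zero] at n3
  rw [jacobiWeight, Nat.add_sub_cancel_left, Nat.add_sub_cancel_left,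
    show -a - (((m + k : ℕ) : ℝ) + m - a - b - 1) = 1 - (2 * m - b) - k by push_cast; ring, hrefl,
    show m + k + 1 = m + (1 + k) by omega, poch_add _ m (1 + k), poch_add _ 1 k, poch_succ _ 0,
    poch_zero, poch_add ((m + k : ℕ) - a - b - 1) m t,
    show (m : ℝ) - b - 1 + m + (1 : ℕ) = 2 * m - b by push_cast; ring,
    show (m : ℝ) - b - 1 + m + (0 : ℕ) = 2 * m - b - 1 by push_cast; ring,
    show ((m + k : ℕ) : ℝ) - a - b - 1 + m = (m + k : ℕ) + m - a - b - 1 by ring]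
  push_cast at n1 n2 n3 n4
  rw [show (m : ℝ) - 1 - b = m - b - 1 by ring] at n1
  have n3' : 2 * (m : ℝ) - b - 1 ≠ 0 := fun h => n3 (by linarith)
  have sg : (-1 : ℝ) ^ k * (-1) ^ k = 1 := by rw [← mul_pow]; simp
  generalize poch (((m + k : ℕ) : ℝ) + m - a - b - 1) t = p1
  generalize poch (((m + k : ℕ) : ℝ) - a - b - 1) m = p2
  field_simp
  linear_combination -(e 0 (m + t) * p1 * p2) * hch' + e 0 (m + t) * p1 * p2 * ((m + k).choose m : ℝ) * (k.choose t : ℝ) * sg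

/-- Since `r.choose q` removes the terms `r < q`, this is the Pfaff transformation of degree `n - q`
with `B` and `C` raised by `q`, applied to the array shifted by `q`. -/
theorem sum_choose_mul_choose_eq_sum_diag {n q : ℕ} (hq : q ≤ n) {a : ℝ} (ha : ∀ z : ℤ, a ≠ z)
    (b : ℝ) (e : ℕ → ℕ → ℝ) (he : ∀ i k, i + k < n → e i k = e (i + 1) k + e i (k + 1)) :
    ∑ r ∈ range (n + 1), (-1) ^ r * (n.choose r : ℝ) * (r.choose q : ℝ) *
        poch (n - 1 - a - b) r / poch (-a) r * e r 0 =
      ∑ j ∈ range (n + 1), (-1) ^ q * (n.choose j : ℝ) * (j.choose q : ℝ) *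
        poch (n - a - b - 1) q * poch (b + 1 - n) (j - q) / poch (-a) j * e j (n - j) := by
  obtain ⟨k, rfl⟩ := Nat.exists_eq_add_of_le hq
  have nza : ∀ k : ℕ, poch (-a) k ≠ 0 := fun k =>
    poch_ne_zero_of_not_int (fun w h => ha (-w) (by push_cast; linarith)) k
  have h := sum_pfaff k ((q + k : ℕ) - 1 - a - b + q) (-a + q) (fun i j => e (q + i) j)
    (fun i _ h => ha (q + i) (by push_cast; linarith)) (fun i j h => he (q + i) j (by omega))
  rw [add_assoc q k 1, sum_range_add _ q (k + 1), sum_range_add _ q (k + 1)]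
  rw [sum_eq_zero (s := range q) fun x hx => by
    rw [Nat.choose_eq_zero_of_lt (n := x) (by simpa using hx)]; simp]
  rw [sum_eq_zero (s := range q) fun x hx => by
    rw [Nat.choose_eq_zero_of_lt (n := x) (by simpa using hx)]; simp]
  rw [zero_add, zero_add]
  have h' := congrArg (fun w => (-1) ^ q * ((q + k).choose q : ℝ) *
    poch ((q + k : ℕ) - a - b - 1) q / poch (-a) q * w) h
  simp only [mul_sum] at h'
  have hch : ∀ i ∈ range (k + 1), ((q + k).choose (q + i) : ℝ) * ((q + i).choose q : ℝ) =
      ((q + k).choose q : ℝ) * (k.choose i : ℝ) := fun i hi => by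
    have hch := Nat.choose_mul (n := q + k) (k := q + i) (s := q) (by omega)
    rw [show q + k - q = k by omega, show q + i - q = i by omega] at hch
    exact_mod_cast hch
  refine Eq.trans (sum_congr rfl fun i hi => ?_) (h'.trans (sum_congr rfl fun i hi => ?_))
  · have n1 := nza q
    have n2 := nza (q + i)
    rw [poch_add] at n2
    rw [poch_add, poch_add, mul_assoc ((-1) ^ (q + i)), hch i hi, pow_add,
      show ((q + k : ℕ) : ℝ) - 1 - a - b = (q + k : ℕ) - a - b - 1 by ring]
    have n3 := right_ne_zero_of_mul n2
    field_simp
  · have n1 := nza q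
    have n2 := nza (q + i)
    rw [poch_add] at n2
    rw [poch_add, mul_assoc ((-1) ^ q) ((q + k).choose (q + i) : ℝ), hch i hi, Nat.add_sub_cancel_left,
      show q + k - (q + i) = k - i by omega,
      show -a + q - (((q + k : ℕ) : ℝ) - 1 - a - b + q) = b + 1 - (q + k : ℕ) by ring]
    have n3 := right_ne_zero_of_mul n2
    field_simp

/-- Bilinear expansion of `₂F₁(-n, n - 1 - a - b; -a; s t)` in products of Jacobi polynomials. -/
theorem sum_jacobiWeight_mul_jacobiSum (n : ℕ) {a b : ℝ} (ha : ∀ z : ℤ, a ≠ z)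
    (hb : ∀ z : ℤ, b ≠ z) (e e' : ℕ → ℕ → ℝ)
    (he : ∀ i k, i + k < n → e i k = e (i + 1) k + e i (k + 1))
    (he' : ∀ i k, i + k < n → e' i k = e' (i + 1) k + e' i (k + 1)) :
    ∑ m ∈ range (n + 1), jacobiWeight n a b m * (jacobiSum n a b m e * jacobiSum n a b m e') =
      ∑ r ∈ range (n + 1), (-1) ^ r * (n.choose r : ℝ) * poch (n - 1 - a - b) r / poch (-a) r *
        (e r 0 * e' r 0) := by
  have lhs : ∑ m ∈ range (n + 1),
      jacobiWeight n a b m * (jacobiSum n a b m e * jacobiSum n a b m e') =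
      ∑ q ∈ range (n + 1), ∑ j ∈ range (n + 1), e 0 q * e' j (n - j) *
        ((n.choose q : ℝ) * poch (n - a - b - 1) q / poch (-a) j) *
        ∑ m ∈ range (n + 1), ((-1) ^ (q - m) * (q.choose m : ℝ) /
          (poch (m - b - 1) m * poch (2 * m - b) (q - m))) *
          (((n - m).choose j : ℝ) * poch (b + 1 - n - m) j) := by
    have : ∀ m ∈ range (n + 1),
        jacobiWeight n a b m * (jacobiSum n a b m e * jacobiSum n a b m e') =
        ∑ q ∈ range (n + 1), ∑ j ∈ range (n + 1), e 0 q * e' j (n - j) *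
        ((n.choose q : ℝ) * poch (n - a - b - 1) q / poch (-a) j) *
        (((-1) ^ (q - m) * (q.choose m : ℝ) /
          (poch (m - b - 1) m * poch (2 * m - b) (q - m))) *
          (((n - m).choose j : ℝ) * poch (b + 1 - n - m) j)) := by
      intro m hm
      have hm' : m ≤ n := by simp at hm; omega
      rw [← mul_assoc, jacobiWeight_mul_jacobiSum hm' ha hb e he,
        jacobiSum_eq_sum_diag hm' ha b e' he', sum_mul_sum]
      refine sum_congr rfl fun q _ => sum_congr rfl fun j _ => ?_
      ring
    rw [sum_congr rfl this, sum_comm]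
    refine sum_congr rfl fun q _ => ?_
    rw [sum_comm]
    refine sum_congr rfl fun j _ => ?_
    rw [mul_sum]
  have rhs : ∑ r ∈ range (n + 1), (-1) ^ r * (n.choose r : ℝ) * poch (n - 1 - a - b) r /
      poch (-a) r * (e r 0 * e' r 0) =
      ∑ q ∈ range (n + 1), ∑ j ∈ range (n + 1), e 0 q * e' j (n - j) *
        ((n.choose j : ℝ) * (j.choose q : ℝ) *
        poch (n - a - b - 1) q * poch (b + 1 - n) (j - q) / poch (-a) j) := by
    have h1 : ∀ r ∈ range (n + 1), (-1) ^ r * (n.choose r : ℝ) * poch (n - 1 - a - b) r /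
        poch (-a) r * (e r 0 * e' r 0) = ∑ q ∈ range (n + 1), (-1) ^ q * e 0 q *
        ((-1) ^ r * (n.choose r : ℝ) * (r.choose q : ℝ) *
        poch (n - 1 - a - b) r / poch (-a) r * e' r 0) := by
      intro r hr
      have hr' : r ≤ n := by simp at hr; omega
      rw [sum_binomial_inversion r e (fun i j h => he i j (by omega)), sum_mul, mul_sum]
      refine Eq.trans ?_ (sum_subset (s₁ := range (r + 1)) (by simpa using hr') ?_)
      · refine sum_congr rfl fun q _ => ?_
        ring
      · intro q _ hq
        rw [Nat.choose_eq_zero_of_lt (n := r) (by simp at hq; omega)]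
        simp
    rw [sum_congr rfl h1, sum_comm]
    refine sum_congr rfl fun q hq => ?_
    rw [← mul_sum, sum_choose_mul_choose_eq_sum_diag (by simp at hq; omega) ha b e' he', mul_sum]
    refine sum_congr rfl fun j _ => ?_
    have sg : (-1 : ℝ) ^ q * (-1) ^ q = 1 := by rw [← mul_pow]; simp
    linear_combination (e 0 q * e' j (n - j) * ((n.choose j : ℝ) * (j.choose q : ℝ) *
        poch (n - a - b - 1) q * poch (b + 1 - n) (j - q) / poch (-a) j)) * sg
  rw [lhs, rhs]
  refine sum_congr rfl fun q hq => sum_congr rfl fun j hj => ?_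
  have hq' : q ≤ n := by simp at hq; omega
  have hj' : j ≤ n := by simp at hj; omega
  have fj : (j.factorial : ℝ) ≠ 0 := by positivity
  -- The binomial in `n - m` is `(m - n)_j` up to a constant, so the product is a polynomial in `m(m
  -- - b - 1)`; orthogonality picks out its `q`-th Newton coefficient.
  have inner : ∑ m ∈ range (n + 1), ((-1) ^ (q - m) * (q.choose m : ℝ) /
          (poch (m - b - 1) m * poch (2 * m - b) (q - m))) *
          (((n - m).choose j : ℝ) * poch (b + 1 - n - m) j) =
      (-1) ^ j / (j.factorial : ℝ) * ((j.choose q : ℝ) * poch (q - n) (j - q) *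
        poch (b + 1 - n) (j - q) * ((-1) ^ q * (q.factorial : ℝ))) := by
    have h1 : ∀ m ∈ range (n + 1), ((-1) ^ (q - m) * (q.choose m : ℝ) /
          (poch (m - b - 1) m * poch (2 * m - b) (q - m))) *
          (((n - m).choose j : ℝ) * poch (b + 1 - n - m) j) =
        ∑ p ∈ range (j + 1), (-1) ^ j / (j.factorial : ℝ) * ((j.choose p : ℝ) * poch (p - n) (j - p) *
        poch (b + 1 - n) (j - p)) * ((-1) ^ (q - m) * (q.choose m : ℝ) /
        (poch (m - b - 1) m * poch (2 * m - b) (q - m)) *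
          (poch (-(m : ℝ)) p * poch (m - b - 1) p)) := by
      intro m hm
      have hm' : m ≤ n := by simp at hm; omega
      have h2 := poch_mul_poch_expansion j n m b
      have h3 := poch_neg_natCast (n - m) j
      rw [Nat.cast_sub hm', neg_sub] at h3
      have sg : (-1 : ℝ) ^ j * (-1) ^ j = 1 := by rw [← mul_pow]; simp
      have h4 : ((n - m).choose j : ℝ) = (-1) ^ j / (j.factorial : ℝ) * poch (m - n) j := by
        rw [h3]
        field_simp
        linear_combination (-((n - m).choose j : ℝ)) * sg
      rw [h4, mul_assoc ((-1) ^ j / (j.factorial : ℝ)), h2, mul_sum, mul_sum]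
      refine sum_congr rfl fun p _ => ?_
      ring
    rw [sum_congr rfl h1, sum_comm]
    have h5 : ∀ p ∈ range (j + 1), ∑ m ∈ range (n + 1), (-1) ^ j / (j.factorial : ℝ) *
        ((j.choose p : ℝ) * poch (p - n) (j - p) *
        poch (b + 1 - n) (j - p)) * ((-1) ^ (q - m) * (q.choose m : ℝ) /
        (poch (m - b - 1) m * poch (2 * m - b) (q - m)) *
          (poch (-(m : ℝ)) p * poch (m - b - 1) p)) = (-1) ^ j / (j.factorial : ℝ) *
        ((j.choose p : ℝ) * poch (p - n) (j - p) * poch (b + 1 - n) (j - p)) *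
        if p = q then (-1) ^ q * (q.factorial : ℝ) else 0 := by
      intro p _
      rw [← mul_sum, ← sum_newton_orthogonality p q b hb]
      congr 1
      symm
      refine sum_subset (by simpa using hq') ?_
      intro m _ hm
      rw [Nat.choose_eq_zero_of_lt (n := q) (by simp at hm; omega)]
      simp
    rw [sum_congr rfl h5]
    simp only [mul_ite, mul_zero]
    rw [sum_ite_eq' (range (j + 1)) q]
    split_ifs with hqj
    · ring
    · rw [Nat.choose_eq_zero_of_lt (by simp at hqj; omega)]
      simp
  rw [inner]
  rcases lt_or_ge j q with hjq | hjq
  · rw [Nat.choose_eq_zero_of_lt hjq]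
    simp
  · obtain ⟨t, rfl⟩ := Nat.exists_eq_add_of_le hjq
    have h3 := poch_neg_natCast (n - q) t
    rw [Nat.cast_sub hq', neg_sub] at h3
    have hch := Nat.choose_mul (n := n) (k := q + t) (s := q) (by omega)
    rw [Nat.add_sub_cancel_left] at hch
    have hch' := congrArg (Nat.cast : ℕ → ℝ) hch
    have hf := congrArg (Nat.cast : ℕ → ℝ) (Nat.add_choose_mul_factorial_mul_factorial q t)
    push_cast at hch' hf
    rw [← Nat.choose_symm_add] at hf
    rw [Nat.add_sub_cancel_left, h3]
    have sg : (-1 : ℝ) ^ (q + t) * (-1) ^ t * (-1) ^ q = 1 := by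
      rw [mul_assoc, ← pow_add, add_comm t q, ← mul_pow]; simp
    have : (-1 : ℝ) ^ (q + t) / ((q + t).factorial : ℝ) * (((q + t).choose q : ℝ) *
        ((-1) ^ t * (t.factorial : ℝ) * ((n - q).choose t : ℝ)) * poch (b + 1 - n) t *
        ((-1) ^ q * (q.factorial : ℝ))) = ((n - q).choose t : ℝ) * poch (b + 1 - n) t := by
      rw [div_mul_eq_mul_div, div_eq_iff fj, ← hf]
      linear_combination ((n - q).choose t : ℝ) * poch (b + 1 - n) t * ((q + t).choose q : ℝ) *
        (q.factorial : ℝ) * (t.factorial : ℝ) * sg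
    rw [this, hch']
    ring

/-! ### Hahn polynomials as images of Jacobi polynomials, and the one-variable sum -/

/-- The discrete analogue of the monomials `t ^ i * (1 - t) ^ k` in degree `n`. -/
noncomputable def hahnArray (n : ℕ) (x N : ℝ) (i k : ℕ) : ℝ :=
  poch (-x) i * poch (-(N - x)) k * poch (i + k - N) (n - i - k)

/-- After the common factors are removed this is `(-x + i) + (-(N - x) + k) = i + k - N`. -/
theorem hahnArray_pascal (n : ℕ) (x N : ℝ) (i k : ℕ) (h : i + k < n) :
    hahnArray n x N i k = hahnArray n x N (i + 1) k + hahnArray n x N i (k + 1) := by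
  obtain ⟨t, rfl⟩ : ∃ t, n = i + k + t + 1 := ⟨n - (i + k) - 1, by omega⟩
  simp only [hahnArray]
  rw [show i + k + t + 1 - i - k = t + 1 by omega, show i + k + t + 1 - (i + 1) - k = t by omega,
    show i + k + t + 1 - i - (k + 1) = t by omega, poch_succ_left, poch_succ, poch_succ]
  push_cast
  rw [show (i : ℝ) + k - N + 1 = i + 1 + k - N by ring,
    show (i : ℝ) + (k + 1) - N = i + 1 + k - N by ring]
  ring

theorem hahnCleared_mul_poch {n m : ℕ} (hm : m ≤ n) (x a b N : ℝ) :
    hahnCleared (n - m) x a (b - 2 * m) (N - m) * poch (-(N - x)) m =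
      jacobiSum n a b m (hahnArray n x N) := by
  obtain ⟨k, rfl⟩ := Nat.exists_eq_add_of_le hm
  rw [hahnCleared, jacobiSum, sum_mul, Nat.add_sub_cancel_left]
  refine sum_congr rfl fun i hi => ?_
  have fi : (i.factorial : ℝ) ≠ 0 := by positivity
  rw [poch_neg_natCast, hahnArray, show m + k - i - m = k - i by omega,
    show (k : ℝ) - a - (b - 2 * m) - 1 = (m + k : ℕ) + m - a - b - 1 by push_cast; ring,
    show -(N - m) + (i : ℝ) = i + m - N by ring, mul_comm (poch (-a) i), ← div_div]
  field_simp

/-- The normalizing constant of the kernel of degree `n`. -/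
noncomputable def kernelConst (L : ℝ) (n : ℕ) : ℝ :=
  (-1) ^ n * poch (-L - 1) n * (L + 1 - 2 * n) / ((n.factorial : ℝ) * (L + 1))

/-- The reciprocal squared norm of a one-variable Hahn polynomial, up to the factors
depending on the size of the sample. -/
noncomputable def hahnWeight (a α : ℝ) (t : ℕ) : ℝ :=
  poch (-a) t * poch (-a - α - 1) t / (poch (-α) t * poch (-a - α - 1) (2 * t) * (t.factorial : ℝ))

/-- This matches the norms with the bilinear expansion: the `k`-th term of the smaller kernel
becomes an expansion of degree `n - k` with `b` lowered by `2k`. -/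
theorem hahnWeight_mul_kernelConst {k m n : ℕ} (hkm : k ≤ m) (hmn : m ≤ n) {a b : ℝ}
    (hb : ∀ z : ℤ, b ≠ z) (hL : ∀ z : ℤ, a + b ≠ z) :
    poch (-(a + b)) (2 * n) * hahnWeight a (b - 2 * m) (n - m) / poch (-b) (2 * m) *
        kernelConst b m * (poch (-m) k * poch (m - 1 - b) k) =
      kernelConst (a + b) n * (poch (-n) k * poch (n - 1 - (a + b)) k) *
        jacobiWeight (n - k) a (b - 2 * k) (m - k) := by
  obtain ⟨s, rfl⟩ := Nat.exists_eq_add_of_le hkm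
  obtain ⟨t, rfl⟩ := Nat.exists_eq_add_of_le hmn
  have nzb : ∀ (z : ℤ) (k : ℕ), poch (z - b) k ≠ 0 := fun z k =>
    poch_ne_zero_of_not_int (fun w h => hb (z - w) (by push_cast; linarith)) k
  have nzL : ∀ (z : ℤ) (k : ℕ), poch (z - (a + b)) k ≠ 0 := fun z k =>
    poch_ne_zero_of_not_int (fun w h => hL (z - w) (by push_cast; linarith)) k
  -- `R1` and `R2` cut `(-(a+b)-1)_(2n+1)` and `(-b-1)_(m+n+1)` in two ways each; apart from
  -- factorials and signs, this is the whole comparison.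
  have R1 : (-(a + b) - 1) * poch (-(a + b)) (2 * (k + s + t)) =
      poch (-(a + b) - 1) (k + s + t) * poch ((k + s + t : ℕ) - 1 - (a + b)) k *
      poch ((k + s + t : ℕ) + k - 1 - (a + b)) s *
      poch ((k + s + t : ℕ) + (k + s : ℕ) - 1 - (a + b)) t * (2 * (k + s + t : ℕ) - (a + b) - 1) := by
    have h := poch_succ_left (-(a + b) - 1) (2 * (k + s + t))
    rw [sub_add_cancel] at h
    rw [← h, show 2 * (k + s + t) + 1 = (k + s + t) + (k + (s + (t + 1))) by omega, poch_add,
      poch_add _ k, poch_add _ s, poch_succ _ t]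
    push_cast
    ring_nf
  have R2 : (-b - 1) * (poch (-b) (2 * (k + s)) * poch (2 * (k + s : ℕ) - b) t) =
      poch (-b - 1) (k + s) * poch ((k + s : ℕ) - 1 - b) k *
        poch ((k + s : ℕ) + k - 1 - b) (s + t + 1) := by
    have h := poch_succ_left (-b - 1) (2 * (k + s) + t)
    rw [sub_add_cancel, poch_add (-b)] at h
    rw [show 2 * ((k + s : ℕ) : ℝ) - b = -b + (2 * (k + s) : ℕ) by push_cast; ring, ← h,
      show 2 * (k + s) + t + 1 = (k + s) + (k + (s + t + 1)) by omega,
      poch_add _ (k + s) (k + (s + t + 1)), poch_add _ k (s + t + 1)]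
    push_cast
    ring_nf
  have F1 := congrArg (Nat.cast : ℕ → ℝ) (Nat.add_choose_mul_factorial_mul_factorial k s)
  have F2 := congrArg (Nat.cast : ℕ → ℝ) (Nat.add_choose_mul_factorial_mul_factorial k (s + t))
  have F3 := congrArg (Nat.cast : ℕ → ℝ) (Nat.add_choose_mul_factorial_mul_factorial s t)
  rw [← Nat.choose_symm_add] at F1 F2 F3
  push_cast at F1 F2 F3
  have b1 := nzb (-1) (k + s)
  have b2 := nzb (((k + s : ℕ) : ℤ) - 1) k
  have b3 := nzb (((k + s : ℕ) : ℤ) + k - 1) (s + t + 1)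
  have b4 := nzb 0 (2 * (k + s))
  have b5 := nzb (2 * ((k + s : ℕ) : ℤ)) t
  have b6 : b + 1 ≠ 0 := fun h => hb (-1) (by push_cast; linarith)
  have l1 := nzL (((k + s + t : ℕ) : ℤ) + (k + s : ℕ) - 1) t
  have l2 := nzL (2 * ((k + s : ℕ) : ℤ) - 1) t
  have l3 : a + b + 1 ≠ 0 := fun h => hL (-1) (by push_cast; linarith)
  rw [hahnWeight, kernelConst, kernelConst, jacobiWeight, poch_neg_natCast, poch_neg_natCast,
    show k + s + t - k = s + t by omega, show k + s - k = s by omega,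
    show k + s + t - (k + s) = t by omega, show s + t - s = t by omega, two_mul t, poch_add _ t t]
  rw [show k + s + t = k + (s + t) by omega] at *
  have f1 : ((k + s).factorial : ℝ) ≠ 0 := by positivity
  have f2 : ((k + (s + t)).factorial : ℝ) ≠ 0 := by positivity
  have f3 : (k.factorial : ℝ) ≠ 0 := by positivity
  have f4 : (s.factorial : ℝ) ≠ 0 := by positivity
  have f5 : (t.factorial : ℝ) ≠ 0 := by positivity
  have f6 : ((s + t).factorial : ℝ) ≠ 0 := by positivity
  have c1 : ((k + s).choose k : ℝ) = (k + s).factorial / (k.factorial * s.factorial) := by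
    rw [eq_div_iff (by positivity), ← F1]; ring
  have c2 : ((k + (s + t)).choose k : ℝ) =
      (k + (s + t)).factorial / (k.factorial * (s + t).factorial) := by
    rw [eq_div_iff (by positivity), ← F2]; ring
  have c3 : ((s + t).choose s : ℝ) = (s + t).factorial / (s.factorial * t.factorial) := by
    rw [eq_div_iff (by positivity), ← F3]; ring
  rw [c1, c2, c3]
  rw [show -(b - 2 * ((k + s : ℕ) : ℝ)) = 2 * (k + s : ℕ) - b by ring,
    show -a - (b - 2 * ((k + s : ℕ) : ℝ)) - 1 + t = (k + (s + t) : ℕ) + (k + s : ℕ) - 1 - (a + b) by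
      push_cast; ring,
    show -a - (b - 2 * ((k + s : ℕ) : ℝ)) - 1 = 2 * (k + s : ℕ) - 1 - (a + b) by ring,
    show ((s + t : ℕ) : ℝ) - a - (b - 2 * k) - 1 = (k + (s + t) : ℕ) + k - 1 - (a + b) by
      push_cast; ring,
    show 2 * (s : ℝ) - (b - 2 * k) - 1 = 2 * (k + s : ℕ) - b - 1 by push_cast; ring,
    show (s : ℝ) - (b - 2 * k) - 1 = (k + s : ℕ) + k - 1 - b by push_cast; ring]
  simp only [Int.cast_sub, Int.cast_add, Int.cast_mul, Int.cast_natCast, Int.cast_one, Int.cast_zero,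
    Int.cast_neg, Int.cast_ofNat, zero_sub] at b1 b2 b3 b4 b5 l1 l2
  rw [show (-1 : ℝ) - b = -b - 1 by ring] at b1
  have sg : (-1 : ℝ) ^ (k + (s + t)) = (-1) ^ (k + s) * (-1) ^ t := by ring
  have sg2 : (-1 : ℝ) ^ t * (-1) ^ t = 1 := by rw [← mul_pow]; simp
  rw [sg]
  have R1' : poch (-(a + b)) (2 * (k + (s + t))) =
      -(poch (-(a + b) - 1) (k + (s + t)) * poch ((k + (s + t) : ℕ) - 1 - (a + b)) k *
      poch ((k + (s + t) : ℕ) + k - 1 - (a + b)) s *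
      poch ((k + (s + t) : ℕ) + (k + s : ℕ) - 1 - (a + b)) t *
        (2 * (k + (s + t) : ℕ) - (a + b) - 1)) / (a + b + 1) := by
    rw [eq_div_iff l3]
    linear_combination -R1
  have R2' : poch ((k + s : ℕ) + k - 1 - b) (s + t + 1) =
      -(b + 1) * (poch (-b) (2 * (k + s)) * poch (2 * (k + s : ℕ) - b) t) /
        (poch (-b - 1) (k + s) * poch ((k + s : ℕ) - 1 - b) k) := by
    rw [eq_div_iff (mul_ne_zero b1 b2)]
    linear_combination -R2
  rw [R1', R2']
  clear R1 R2 R1' R2' F1 F2 F3 c1 c2 c3 b3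
  generalize poch (-b - 1) (k + s) = v1 at *
  generalize poch (((k + s : ℕ) : ℝ) - 1 - b) k = v2 at *
  generalize poch (-b) (2 * (k + s)) = v3 at *
  generalize poch (2 * ((k + s : ℕ) : ℝ) - b) t = v4 at *
  generalize poch (((k + (s + t) : ℕ) : ℝ) + (k + s : ℕ) - 1 - (a + b)) t = v5 at *
  generalize poch (2 * ((k + s : ℕ) : ℝ) - 1 - (a + b)) t = v6 at *
  generalize poch (-(a + b) - 1) (k + (s + t)) = v7 at *
  generalize poch (((k + (s + t) : ℕ) : ℝ) - 1 - (a + b)) k = v8 at *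
  generalize poch (((k + (s + t) : ℕ) : ℝ) + k - 1 - (a + b)) s = v9 at *
  generalize poch (-a) t = v10 at *
  field_simp
  linear_combination (v7 * v8 * v9 * v10 * (a + b + 1 - 2 * ((k + (s + t) : ℕ) : ℝ)) *
    (2 * ((k + s : ℕ) : ℝ) - b - 1)) * sg2

/-- The one-variable summation underlying the induction on the number of variables. -/
theorem sum_hahnCleared_mul_hahnCleared {n k : ℕ} (hk : k ≤ n) {a b : ℝ} (ha : ∀ z : ℤ, a ≠ z)
    (hb : ∀ z : ℤ, b ≠ z) (hL : ∀ z : ℤ, a + b ≠ z) (x y N M : ℝ) :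
    ∑ m ∈ range (n + 1), poch (-(a + b)) (2 * n) * hahnWeight a (b - 2 * m) (n - m) /
        poch (-b) (2 * m) * (hahnCleared (n - m) x a (b - 2 * m) (N - m) *
          hahnCleared (n - m) y a (b - 2 * m) (M - m)) *
        (kernelConst b m * (poch (-m) k * poch (m - 1 - b) k * poch (-(N - x) + k) (m - k) *
          poch (-(M - y) + k) (m - k))) =
      kernelConst (a + b) n * ∑ j ∈ range (n - k + 1), poch (-n) (k + j) *
        poch (n - 1 - (a + b)) (k + j) * poch (-N + (k + j : ℕ)) (n - (k + j)) *
        poch (-M + (k + j : ℕ)) (n - (k + j)) *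
        (poch (-x) j * poch (-y) j / (poch (-a) j * (j.factorial : ℝ))) := by
  obtain ⟨p, rfl⟩ := Nat.exists_eq_add_of_le hk
  rw [Nat.add_sub_cancel_left, add_assoc k p 1, sum_range_add _ k (p + 1)]
  -- The factor `(-m)_k` vanishes for `m < k`, so the sum starts at `m = k`.
  rw [sum_eq_zero (s := range k) fun m hm => by
    rw [poch_neg_natCast m k, Nat.choose_eq_zero_of_lt (by simpa using hm)]; simp]
  have hb' : ∀ z : ℤ, b - 2 * k ≠ z := fun z h => hb (z + 2 * k) (by push_cast; linarith)
  have core := sum_jacobiWeight_mul_jacobiSum p ha hb' (hahnArray p x (N - k))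
    (hahnArray p y (M - k)) (hahnArray_pascal p x (N - k)) (hahnArray_pascal p y (M - k))
  rw [zero_add]
  have core' := congrArg (fun w => kernelConst (a + b) (k + p) * (poch (-((k + p : ℕ) : ℝ)) k *
    poch ((k + p : ℕ) - 1 - (a + b)) k) * w) core
  simp only [mul_sum] at core' ⊢
  refine Eq.trans (sum_congr rfl fun s hs => ?_) (core'.trans (sum_congr rfl fun j hj => ?_))
  · have hs' : s ≤ p := by simp at hs; omega
    have hw := hahnWeight_mul_kernelConst (k := k) (m := k + s) (n := k + p) (by omega) (by omega)
      hb hL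
    rw [Nat.add_sub_cancel_left, Nat.add_sub_cancel_left] at hw
    rw [← hahnCleared_mul_poch hs', ← hahnCleared_mul_poch hs', Nat.add_sub_cancel_left]
    rw [show k + p - (k + s) = p - s by omega] at *
    rw [show b - 2 * (k : ℝ) - 2 * s = b - 2 * (k + s : ℕ) by push_cast; ring,
      show N - (k : ℝ) - s = N - (k + s : ℕ) by push_cast; ring,
      show M - (k : ℝ) - s = M - (k + s : ℕ) by push_cast; ring,
      show -(N - (k : ℝ) - x) = -(N - x) + k by ring, show -(M - (k : ℝ) - y) = -(M - y) + k by ring]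
    linear_combination (hahnCleared (p - s) x a (b - 2 * (k + s : ℕ)) (N - (k + s : ℕ)) *
      poch (-(N - x) + k) s * (hahnCleared (p - s) y a (b - 2 * (k + s : ℕ)) (M - (k + s : ℕ)) *
      poch (-(M - y) + k) s)) * hw
  · have fj : (j.factorial : ℝ) ≠ 0 := by positivity
    simp only [hahnArray, poch_zero, mul_one, Nat.sub_zero, Nat.cast_zero, add_zero]
    rw [poch_add _ k j, poch_add _ k j, show -((k + p : ℕ) : ℝ) + k = -(p : ℝ) by push_cast; ring,
      poch_neg_natCast p j, show k + p - (k + j) = p - j by omega,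
      show ((k + p : ℕ) : ℝ) - 1 - (a + b) + k = p - 1 - a - (b - 2 * k) by push_cast; ring,
      show -N + ((k + j : ℕ) : ℝ) = j - (N - k) by push_cast; ring,
      show -M + ((k + j : ℕ) : ℝ) = j - (M - k) by push_cast; ring, mul_comm (poch (-a) j), ← div_div]
    generalize kernelConst (a + b) (k + p) = w1
    generalize poch (-a) j = w2
    generalize poch ((p : ℝ) - 1 - a - (b - 2 * k)) j = w3
    generalize poch (-((k + p : ℕ) : ℝ)) k = w4
    generalize poch (((k + p : ℕ) : ℝ) - 1 - (a + b)) k = w5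
    generalize poch ((j : ℝ) - (N - k)) (p - j) = w6
    generalize poch ((j : ℝ) - (M - k)) (p - j) = w7
    generalize poch (-x) j = w8
    generalize poch (-y) j = w9
    field_simp

theorem sum_piAntidiag_fin_succ {d : ℕ} (n : ℕ) (F : (Fin (d + 1) → ℕ) → ℝ) :
    ∑ ν ∈ piAntidiag (univ : Finset (Fin (d + 1))) n, F ν =
      ∑ m ∈ range (n + 1), ∑ ν ∈ piAntidiag (univ : Finset (Fin d)) m,
        F (Fin.cons (n - m) ν : Fin (d + 1) → ℕ) := by
  rw [sum_sigma']
  refine sum_nbij' (fun ν => ⟨∑ i : Fin d, ν i.succ, fun i => ν i.succ⟩)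
    (fun p => Fin.cons (n - p.1) p.2) ?_ ?_ ?_ ?_ ?_
  · intro ν hν
    simp only [mem_piAntidiag, Fin.sum_univ_succ] at hν
    simp
    omega
  · rintro ⟨m, ν⟩ h
    simp at h
    obtain ⟨h1, rfl⟩ := h
    simp [Fin.sum_univ_succ]
    exact Nat.sub_add_cancel (show univ.sum ν ≤ n by omega)
  · intro ν hν
    simp only [mem_piAntidiag, Fin.sum_univ_succ] at hν
    funext i
    refine Fin.cases ?_ (fun i => ?_) i
    · simp; omega
    · simp
  · rintro ⟨m, ν⟩ h
    simp at h
    obtain ⟨h1, rfl⟩ := h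
    simp
  · intro ν hν
    simp only [mem_piAntidiag, Fin.sum_univ_succ] at hν
    congr 1
    funext i
    refine Fin.cases ?_ (fun i => ?_) i
    · simp; omega
    · simp

/-! ### Real parameters and the splitting of the first variable -/

/-- The parameters `α_j` for real `ℓ`. -/
noncomputable def realAlpha {d : ℕ} (ℓ : Fin (d + 1) → ℝ) (ν : Fin d → ℕ) (j : Fin d) : ℝ :=
  (∑ i ∈ Ioi j.castSucc, ℓ i) - 2 * (tailSum ν j : ℝ)

/-- The multivariable Hahn polynomial for real `ℓ`. -/
noncomputable def realHahn {d : ℕ} (ℓ : Fin (d + 1) → ℝ) (N : ℝ) (ν : Fin d → ℕ)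
    (x : Fin d → ℝ) : ℝ :=
  ∏ j : Fin d, hahnCleared (ν j) (x j) (ℓ j.castSucc) (realAlpha ℓ ν j)
    (N - (∑ i ∈ Iio j, x i) - tailSum ν j)

/-- The part of the reciprocal squared norm that does not depend on `N`, for real `ℓ`. -/
noncomputable def realWeight {d : ℕ} (ℓ : Fin (d + 1) → ℝ) (ν : Fin d → ℕ) : ℝ :=
  poch (-∑ i, ℓ i) (2 * ∑ i, ν i) *
    ∏ j : Fin d, hahnWeight (ℓ j.castSucc) (realAlpha ℓ ν j) (ν j)

/-- The sums `E_k` for real `ℓ`, in homogeneous coordinates. -/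
noncomputable def realE {d : ℕ} (ℓ : Fin d → ℝ) (k : ℕ) (X Y : Fin d → ℝ) : ℝ :=
  ∑ γ ∈ piAntidiag (univ : Finset (Fin d)) k,
    ∏ i, (poch (-X i) (γ i) * poch (-Y i) (γ i) / (poch (-ℓ i) (γ i) * ((γ i).factorial : ℝ)))

theorem tailSum_cons_zero {d : ℕ} (t : ℕ) (ν : Fin d → ℕ) :
    tailSum (Fin.cons t ν : Fin (d + 1) → ℕ) 0 = ∑ i, ν i := by
  simp [tailSum]

theorem tailSum_cons_succ {d : ℕ} (t : ℕ) (ν : Fin d → ℕ) (j : Fin d) :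
    tailSum (Fin.cons t ν : Fin (d + 1) → ℕ) j.succ = tailSum ν j := by
  simp [tailSum, Fin.sum_Ioi_succ]

theorem realAlpha_cons_zero {d : ℕ} (ℓ : Fin (d + 2) → ℝ) (t : ℕ) (ν : Fin d → ℕ) :
    realAlpha ℓ (Fin.cons t ν : Fin (d + 1) → ℕ) 0 =
      ∑ i : Fin (d + 1), ℓ i.succ - 2 * (∑ i, ν i : ℕ) := by
  rw [realAlpha, tailSum_cons_zero, Fin.castSucc_zero, Fin.sum_Ioi_zero]

theorem realAlpha_cons_succ {d : ℕ} (ℓ : Fin (d + 2) → ℝ) (t : ℕ) (ν : Fin d → ℕ) (j : Fin d) :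
    realAlpha ℓ (Fin.cons t ν : Fin (d + 1) → ℕ) j.succ = realAlpha (fun i => ℓ i.succ) ν j := by
  rw [realAlpha, tailSum_cons_succ, ← Fin.succ_castSucc, Fin.sum_Ioi_succ, realAlpha]

theorem sum_Iio_succ {d : ℕ} (x : Fin (d + 1) → ℝ) (j : Fin d) :
    ∑ i ∈ Iio j.succ, x i = x 0 + ∑ i ∈ Iio j, x i.succ := by
  have : Iio j.succ = insert 0 ((Iio j).map (Fin.succEmb d)) := by
    ext i
    refine Fin.cases ?_ (fun i => ?_) i
    · simp
    · simp
  rw [this, sum_insert (by simp), sum_map]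
  simp

theorem realHahn_cons {d : ℕ} (ℓ : Fin (d + 2) → ℝ) (N : ℝ) (t : ℕ) (ν : Fin d → ℕ)
    (x : Fin (d + 1) → ℝ) :
    realHahn ℓ N (Fin.cons t ν : Fin (d + 1) → ℕ) x =
      hahnCleared t (x 0) (ℓ 0) (∑ i : Fin (d + 1), ℓ i.succ - 2 * (∑ i, ν i : ℕ))
        (N - (∑ i, ν i : ℕ)) *
      realHahn (fun i => ℓ i.succ) (N - x 0) ν (fun i => x i.succ) := by
  rw [realHahn, Fin.prod_univ_succ, realHahn]
  congr 1
  · have : Iio (0 : Fin (d + 1)) = ∅ := by ext i; simp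
    rw [realAlpha_cons_zero, tailSum_cons_zero, this, sum_empty, sub_zero]
    simp
  · refine prod_congr rfl fun j _ => ?_
    rw [realAlpha_cons_succ, tailSum_cons_succ, sum_Iio_succ, Fin.cons_succ, ← Fin.succ_castSucc,
      ← sub_sub N]

theorem realWeight_cons {d : ℕ} (ℓ : Fin (d + 2) → ℝ) (t : ℕ) (ν : Fin d → ℕ)
    (h : ∀ z : ℤ, ∑ i : Fin (d + 1), ℓ i.succ ≠ z) :
    realWeight ℓ (Fin.cons t ν : Fin (d + 1) → ℕ) =
      poch (-(ℓ 0 + ∑ i : Fin (d + 1), ℓ i.succ)) (2 * (t + ∑ i, ν i)) *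
      hahnWeight (ℓ 0) (∑ i : Fin (d + 1), ℓ i.succ - 2 * (∑ i, ν i : ℕ)) t /
      poch (-∑ i : Fin (d + 1), ℓ i.succ) (2 * ∑ i, ν i) * realWeight (fun i => ℓ i.succ) ν := by
  have nz : poch (-∑ i : Fin (d + 1), ℓ i.succ) (2 * ∑ i, ν i) ≠ 0 :=
    poch_ne_zero_of_not_int (fun w hw => h (-w) (by push_cast; linarith)) _
  rw [realWeight, realWeight, Fin.prod_univ_succ, realAlpha_cons_zero, Fin.sum_univ_succ (f := ℓ),
    Fin.sum_univ_succ (f := (Fin.cons t ν : Fin (d + 1) → ℕ))]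
  simp only [Fin.cons_zero, Fin.cons_succ, realAlpha_cons_succ, Fin.castSucc_zero,
    ← Fin.succ_castSucc]
  field_simp

theorem realE_succ {d : ℕ} (ℓ : Fin (d + 1) → ℝ) (k : ℕ) (X Y : Fin (d + 1) → ℝ) :
    realE ℓ k X Y = ∑ i ∈ range (k + 1), (poch (-X 0) (k - i) * poch (-Y 0) (k - i) /
      (poch (-ℓ 0) (k - i) * ((k - i).factorial : ℝ))) *
        realE (fun i => ℓ i.succ) i (fun i => X i.succ) (fun i => Y i.succ) := by
  rw [realE, sum_piAntidiag_fin_succ]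
  refine sum_congr rfl fun i _ => ?_
  rw [realE, mul_sum]
  refine sum_congr rfl fun γ _ => ?_
  rw [Fin.prod_univ_succ]
  simp

theorem realE_zero {d : ℕ} (ℓ X Y : Fin d → ℝ) : realE ℓ 0 X Y = 1 := by
  simp [realE, poch_zero]

theorem sum_range_sum_range_eq (n : ℕ) (f : ℕ → ℕ → ℝ) :
    ∑ r ∈ range (n + 1), ∑ k ∈ range (r + 1), f k (r - k) =
      ∑ k ∈ range (n + 1), ∑ j ∈ range (n - k + 1), f k j := by
  rw [sum_sigma', sum_sigma']
  refine sum_nbij' (fun p => ⟨p.2, p.1 - p.2⟩) (fun p => ⟨p.1 + p.2, p.1⟩) ?_ ?_ ?_ ?_ ?_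
  · rintro ⟨r, k⟩ h
    simp at h ⊢
    omega
  · rintro ⟨r, k⟩ h
    simp at h ⊢
    omega
  · rintro ⟨r, k⟩ h
    simp at h ⊢
    omega
  · rintro ⟨r, k⟩ h
    simp
  · rintro ⟨r, k⟩ h
    rfl

/-! ### The kernel identity for generic parameters -/

/-- No parameter and no tail sum of parameters is an integer. -/
def Generic {d : ℕ} (ℓ : Fin d → ℝ) : Prop :=
  (∀ i, ∀ z : ℤ, ℓ i ≠ z) ∧ ∀ j, ∀ z : ℤ, ∑ i ∈ Ici j, ℓ i ≠ z

theorem Generic.tail {d : ℕ} {ℓ : Fin (d + 1) → ℝ} (h : Generic ℓ) :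
    Generic (fun i => ℓ i.succ) := by
  refine ⟨fun i => h.1 i.succ, fun j z hz => h.2 j.succ z ?_⟩
  rw [← hz, ← Fin.map_succEmb_Ici, sum_map]
  simp

theorem Generic.sum_ne {d : ℕ} {ℓ : Fin (d + 1) → ℝ} (h : Generic ℓ) (z : ℤ) :
    ∑ i, ℓ i ≠ z := by
  have := h.2 0 z
  rwa [show Ici (0 : Fin (d + 1)) = univ by ext; simp] at this

/-- The Pfaff transformation at `t = 1`, where the array is `1^i 0^j`, leaves one term, with factor
`(-n)_(n+1) = 0`. -/
theorem sum_chu_vandermonde_eq_zero (n : ℕ) {L : ℝ} (hL : ∀ z : ℤ, L ≠ z) :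
    ∑ k ∈ range (n + 1 + 1), (-1) ^ k * ((n + 1).choose k : ℝ) * poch (n - L) k / poch (-L) k = 0 := by
  have h := sum_pfaff (n + 1) (n - L) (-L) (fun _ j => if j = 0 then 1 else 0)
    (fun i _ h => hL i (by push_cast; linarith)) (fun i j _ => by simp)
  simp only [if_true, mul_one] at h
  rw [h, sum_range_succ, sum_eq_zero]
  · rw [show -L - (n - L) = -(n : ℝ) by ring, poch_neg_natCast n (n + 1)]
    simp
  · intro i hi
    rw [if_neg (by simp at hi; omega), mul_zero]

/-- The kernel identity for generic real parameters, with two independent sample sizes. -/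
theorem sum_realHahn_mul_realHahn {d : ℕ} (ℓ : Fin (d + 1) → ℝ) (hℓ : Generic ℓ)
    (X Y : Fin (d + 1) → ℝ) (n : ℕ) :
    ∑ ν ∈ piAntidiag (univ : Finset (Fin d)) n,
      realHahn ℓ (∑ i, X i) ν (fun i => X i.castSucc) *
      realHahn ℓ (∑ i, Y i) ν (fun i => Y i.castSucc) * realWeight ℓ ν =
    kernelConst (∑ i, ℓ i) n * ∑ k ∈ range (n + 1), poch (-n) k * poch (n - 1 - ∑ i, ℓ i) k *
      poch (-(∑ i, X i) + k) (n - k) * poch (-(∑ i, Y i) + k) (n - k) * realE ℓ k X Y := by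
  induction d generalizing n with
  | zero =>
    have hL : ∀ z : ℤ, ℓ 0 ≠ z := hℓ.1 0
    have l3 : ℓ 0 + 1 ≠ 0 := fun h => hL (-1) (by push_cast; linarith)
    have nz : ∀ k, poch (-ℓ 0) k ≠ 0 := fun k =>
      poch_ne_zero_of_not_int (fun w hw => hL (-w) (by push_cast; linarith)) _
    -- There are no indices `ν` of positive degree, so the right side must vanish for `n > 0`: both
    -- sample-size factors combine to a constant and Chu–Vandermonde remains.
    cases n with
    | zero => simp [realHahn, realWeight, poch_zero, kernelConst, realE_zero, div_self l3]
    | succ n =>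
      have hE : ∀ k, realE ℓ k X Y =
          poch (-X 0) k * poch (-Y 0) k / (poch (-ℓ 0) k * (k.factorial : ℝ)) := by
        intro k
        rw [realE_succ, sum_eq_single 0]
        · rw [realE_zero, Nat.sub_zero, mul_one]
        · intro i _ hi
          rw [realE, univ_eq_empty, piAntidiag_empty_of_ne_zero hi]
          simp
        · simp
      have hz := sum_chu_vandermonde_eq_zero n hL
      rw [univ_eq_empty, piAntidiag_empty_of_ne_zero (by omega), sum_empty]
      have hs : ∀ f : Fin (0 + 1) → ℝ, ∑ i, f i = f 0 := fun f => by simp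
      rw [hs ℓ, hs X, hs Y]
      symm
      refine mul_eq_zero_of_right _ ?_
      rw [← mul_zero (poch (-X 0) (n + 1) * poch (-Y 0) (n + 1)), ← hz, mul_sum]
      refine sum_congr rfl fun k hk => ?_
      have hk' : k ≤ n + 1 := by simp at hk; omega
      have fk : (k.factorial : ℝ) ≠ 0 := by positivity
      have nk := nz k
      rw [hE, poch_neg_natCast, poch_split (-X 0) hk', poch_split (-Y 0) hk',
        show ((n + 1 : ℕ) : ℝ) - 1 - ℓ 0 = n - ℓ 0 by push_cast; ring]
      field_simp
  | succ d ih =>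
    obtain ⟨b, hb⟩ : ∃ b, b = ∑ i : Fin (d + 1), ℓ i.succ := ⟨_, rfl⟩
    have hb' : ∀ z : ℤ, b ≠ z := hb ▸ hℓ.tail.sum_ne
    have hsum : ∑ i, ℓ i = ℓ 0 + b := by rw [hb, Fin.sum_univ_succ]
    have hL : ∀ z : ℤ, ℓ 0 + b ≠ z := hsum ▸ hℓ.sum_ne
    have hX : ∑ i, X i - X 0 = ∑ i : Fin (d + 1), X i.succ := by rw [Fin.sum_univ_succ]; ring
    have hY : ∑ i, Y i - Y 0 = ∑ i : Fin (d + 1), Y i.succ := by rw [Fin.sum_univ_succ]; ring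
    obtain ⟨N, hN⟩ : ∃ N, N = ∑ i, X i := ⟨_, rfl⟩
    obtain ⟨M, hM⟩ : ∃ M, M = ∑ i, Y i := ⟨_, rfl⟩
    obtain ⟨E, hE⟩ : ∃ E : ℕ → ℝ, ∀ k, E k =
      realE (fun i => ℓ i.succ) k (fun i => X i.succ) (fun i => Y i.succ) := ⟨_, fun _ => rfl⟩
    have key : ∀ m ∈ range (n + 1), ∑ ν ∈ piAntidiag (univ : Finset (Fin d)) m,
        realHahn ℓ N (Fin.cons (n - m) ν : Fin (d + 1) → ℕ) (fun i => X i.castSucc) *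
        realHahn ℓ M (Fin.cons (n - m) ν : Fin (d + 1) → ℕ) (fun i => Y i.castSucc) *
        realWeight ℓ (Fin.cons (n - m) ν : Fin (d + 1) → ℕ) =
        ∑ k ∈ range (n + 1), E k * (poch (-(ℓ 0 + b)) (2 * n) *
          hahnWeight (ℓ 0) (b - 2 * m) (n - m) /
          poch (-b) (2 * m) * (hahnCleared (n - m) (X 0) (ℓ 0) (b - 2 * m) (N - m) *
          hahnCleared (n - m) (Y 0) (ℓ 0) (b - 2 * m) (M - m)) *
          (kernelConst b m * (poch (-m) k * poch (m - 1 - b) k * poch (-(N - X 0) + k) (m - k) *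
          poch (-(M - Y 0) + k) (m - k)))) := by
      intro m hm
      have hm' : m ≤ n := by simp at hm; omega
      -- The tails have the sample sizes `N - X 0` and `M - Y 0`, unequal in general even when `N =
      -- M`.
      have h1 := ih (fun i => ℓ i.succ) hℓ.tail (fun i => X i.succ) (fun i => Y i.succ) m
      rw [← hb, ← hX, ← hY, ← hN, ← hM] at h1
      have h2 : ∀ ν ∈ piAntidiag (univ : Finset (Fin d)) m,
          realHahn ℓ N (Fin.cons (n - m) ν : Fin (d + 1) → ℕ) (fun i => X i.castSucc) *
          realHahn ℓ M (Fin.cons (n - m) ν : Fin (d + 1) → ℕ) (fun i => Y i.castSucc) *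
          realWeight ℓ (Fin.cons (n - m) ν : Fin (d + 1) → ℕ) =
          poch (-(ℓ 0 + b)) (2 * n) * hahnWeight (ℓ 0) (b - 2 * m) (n - m) /
          poch (-b) (2 * m) * (hahnCleared (n - m) (X 0) (ℓ 0) (b - 2 * m) (N - m) *
          hahnCleared (n - m) (Y 0) (ℓ 0) (b - 2 * m) (M - m)) *
          (realHahn (fun i => ℓ i.succ) (N - X 0) ν (fun i => X i.castSucc.succ) *
          realHahn (fun i => ℓ i.succ) (M - Y 0) ν (fun i => Y i.castSucc.succ) *
          realWeight (fun i => ℓ i.succ) ν) := by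
        intro ν hν
        have hν' : ∑ i, ν i = m := by simpa using hν
        rw [realHahn_cons, realHahn_cons, realWeight_cons _ _ _ hℓ.tail.sum_ne, ← hb, hν',
          show n - m + m = n by omega]
        simp only [Fin.castSucc_zero, ← Fin.succ_castSucc]
        ring
      rw [sum_congr rfl h2, ← mul_sum, h1, mul_sum, mul_sum]
      -- Terms with `m < k ≤ n` are zero through `(-m)_k`; adding them makes the range independent
      -- of `m`, so that the sums can be exchanged.
      refine Eq.trans (sum_congr rfl fun k _ => ?_)
        (sum_subset (s₁ := range (m + 1)) (by simpa using hm') ?_)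
      · rw [hE]; ring
      · intro k _ hk
        rw [poch_neg_natCast, Nat.choose_eq_zero_of_lt (by simp at hk; omega)]
        simp
    rw [sum_piAntidiag_fin_succ, ← hN, ← hM, sum_congr rfl key, sum_comm, hsum]
    simp only [realE_succ ℓ]
    have h3 : ∀ r ∈ range (n + 1), poch (-n) r * poch (n - 1 - (ℓ 0 + b)) r *
        poch (-N + r) (n - r) * poch (-M + r) (n - r) *
        ∑ i ∈ range (r + 1), (poch (-X 0) (r - i) * poch (-Y 0) (r - i) /
          (poch (-ℓ 0) (r - i) * ((r - i).factorial : ℝ))) *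
          realE (fun i => ℓ i.succ) i (fun i => X i.succ) (fun i => Y i.succ) =
        ∑ k ∈ range (r + 1), E k * (poch (-n) (k + (r - k)) *
          poch (n - 1 - (ℓ 0 + b)) (k + (r - k)) *
          poch (-N + (k + (r - k) : ℕ)) (n - (k + (r - k))) *
          poch (-M + (k + (r - k) : ℕ)) (n - (k + (r - k))) *
          (poch (-X 0) (r - k) * poch (-Y 0) (r - k) /
          (poch (-ℓ 0) (r - k) * ((r - k).factorial : ℝ)))) := by
      intro r _
      rw [mul_sum]
      refine sum_congr rfl fun k hk => ?_
      rw [show k + (r - k) = r by simp at hk; omega, hE]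
      ring
    rw [sum_congr rfl h3, sum_range_sum_range_eq n fun k j => E k * (poch (-n) (k + j) *
      poch (n - 1 - (ℓ 0 + b)) (k + j) * poch (-N + (k + j : ℕ)) (n - (k + j)) *
      poch (-M + (k + j : ℕ)) (n - (k + j)) * (poch (-X 0) j * poch (-Y 0) j /
      (poch (-ℓ 0) j * (j.factorial : ℝ)))), mul_sum]
    refine sum_congr rfl fun k hk => ?_
    rw [← mul_sum, ← mul_sum, sum_hahnCleared_mul_hahnCleared (by simp at hk; omega) (hℓ.1 0) hb' hL]
    ring

/-! ### Passage to integral parameters -/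

theorem continuous_poch (k : ℕ) : Continuous fun a => poch a k :=
  (ascPochhammer ℝ k).continuous

theorem continuousAt_poch {f : ℝ → ℝ} {c : ℝ} (hf : ContinuousAt f c) (k : ℕ) :
    ContinuousAt (fun t => poch (f t) k) c :=
  ((continuous_poch k).continuousAt (x := f c)).comp hf

theorem continuousAt_hahnCleared {f g : ℝ → ℝ} {c : ℝ} (hf : ContinuousAt f c)
    (hg : ContinuousAt g c) (n : ℕ) (x M : ℝ) (h : ∀ k ≤ n, poch (-f c) k ≠ 0) :
    ContinuousAt (fun t => hahnCleared n x (f t) (g t) M) c := by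
  unfold hahnCleared
  refine tendsto_finsetSum _ fun k hk => ?_
  have hk' : k ≤ n := by simp at hk; omega
  have h1 : ContinuousAt (fun t => poch (n - f t - g t - 1) k) c :=
    continuousAt_poch (by fun_prop) k
  have h2 : ContinuousAt (fun t => poch (-f t) k) c := continuousAt_poch (by fun_prop) k
  exact ((((continuousAt_const.mul h1).mul continuousAt_const).div (h2.mul continuousAt_const)
    (mul_ne_zero (h k hk') (by positivity))).mul continuousAt_const)

theorem continuousAt_hahnWeight {f g : ℝ → ℝ} {c : ℝ} (hf : ContinuousAt f c)
    (hg : ContinuousAt g c) (n : ℕ) (h1 : poch (-g c) n ≠ 0)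
    (h2 : poch (-f c - g c - 1) (2 * n) ≠ 0) :
    ContinuousAt (fun t => hahnWeight (f t) (g t) n) c := by
  unfold hahnWeight
  have c1 : ContinuousAt (fun t => poch (-f t) n) c := continuousAt_poch (by fun_prop) n
  have c2 : ContinuousAt (fun t => poch (-f t - g t - 1) n) c := continuousAt_poch (by fun_prop) n
  have c3 : ContinuousAt (fun t => poch (-g t) n) c := continuousAt_poch (by fun_prop) n
  have c4 : ContinuousAt (fun t => poch (-f t - g t - 1) (2 * n)) c :=
    continuousAt_poch (by fun_prop) (2 * n)
  exact (c1.mul c2).div ((c3.mul c4).mul continuousAt_const)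
    (mul_ne_zero (mul_ne_zero h1 h2) (by positivity))

/-- A sum of `c` shifted parameters is an integer plus `c * ε`, and `0 < c * ε < 1` for `1 ≤ c ≤ d +
1`. -/
theorem generic_natCast_add {d : ℕ} (ℓ : Fin (d + 1) → ℕ) {ε : ℝ} (h0 : 0 < ε)
    (h1 : ε * (d + 2) < 1) : Generic fun i => (ℓ i : ℝ) + ε := by
  have key : ∀ (c : ℕ) (A : ℕ) (z : ℤ), 1 ≤ c → c ≤ d + 1 → (A : ℝ) + c * ε ≠ z := by
    intro c A z hc hc' h
    have hc1 : (1 : ℝ) ≤ c := by exact_mod_cast hc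
    have hc2 : (c : ℝ) ≤ d + 1 := by exact_mod_cast hc'
    have e : (c : ℝ) * ε = ((z - A : ℤ) : ℝ) := by push_cast; linarith
    have p : (0 : ℝ) < ((z - A : ℤ) : ℝ) := by rw [← e]; positivity
    have q : ((z - A : ℤ) : ℝ) < 1 := by rw [← e]; nlinarith
    have p' : 0 < z - A := by exact_mod_cast p
    have q' : z - A < 1 := by exact_mod_cast q
    omega
  refine ⟨fun i z => by simpa using key 1 (ℓ i) z le_rfl (by omega), fun j z => ?_⟩
  rw [sum_add_distrib, sum_const, nsmul_eq_mul, ← Nat.cast_sum]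
  refine key _ _ z (card_pos.mpr ⟨j, by simp⟩) ?_
  simp

/-- If at least two parameters follow `j`, their sum is at least `2n`, which suffices. If only the
last one follows, `tailSum ν j` is empty and `ν j ≤ n` is enough. -/
theorem add_two_mul_tailSum_le {d : ℕ} (ℓ : Fin (d + 1) → ℕ) {n : ℕ} (hn : ∀ i, n ≤ ℓ i)
    {ν : Fin d → ℕ} (hν : ∑ i, ν i = n) (j : Fin d) :
    ν j + 2 * tailSum ν j ≤ ∑ i ∈ Ioi j.castSucc, ℓ i := by
  have h1 : (Ioi j.castSucc).card * n ≤ ∑ i ∈ Ioi j.castSucc, ℓ i := by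
    simpa using card_nsmul_le_sum (Ioi j.castSucc) ℓ n fun i _ => hn i
  have h2 : ν j + tailSum ν j ≤ n := by
    rw [← hν, tailSum, ← sum_insert (by simp)]
    exact sum_le_sum_of_subset (subset_univ _)
  have hj := j.2
  rw [Fin.card_Ioi] at h1
  simp only [Fin.val_castSucc] at h1
  rcases Nat.lt_or_ge (j + 1) d with h | h
  · have : 2 * n ≤ (d + 1 - 1 - j) * n := Nat.mul_le_mul_right n (by omega)
    omega
  · have h0 : tailSum ν j = 0 := by
      refine sum_eq_zero fun i hi => ?_
      have : j < i := by simpa using hi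
      have := i.2
      omega
    rw [show d + 1 - 1 - (j : ℕ) = 1 by omega] at h1
    omega

theorem realAlpha_natCast {d : ℕ} (ℓ : Fin (d + 1) → ℕ) (ν : Fin d → ℕ) (j : Fin d) :
    realAlpha (fun i => (ℓ i : ℝ)) ν j = (alpha ℓ ν j : ℝ) := by
  simp [realAlpha, alpha]

theorem le_alpha {d : ℕ} (ℓ : Fin (d + 1) → ℕ) {n : ℕ} (hn : ∀ i, n ≤ ℓ i)
    {ν : Fin d → ℕ} (hν : ∑ i, ν i = n) (j : Fin d) : (ν j : ℤ) ≤ alpha ℓ ν j := by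
  have h := add_two_mul_tailSum_le ℓ hn hν j
  have h' : ((ν j + 2 * tailSum ν j : ℕ) : ℤ) ≤ ((∑ i ∈ Ioi j.castSucc, ℓ i : ℕ) : ℤ) :=
    Int.ofNat_le.mpr h
  push_cast at h'
  rw [alpha]
  linarith

theorem poch_neg_intCast_ne_zero {z : ℤ} {k : ℕ} (h : (k : ℤ) ≤ z) : poch (-(z : ℝ)) k ≠ 0 := by
  obtain ⟨m, rfl⟩ := Int.eq_ofNat_of_zero_le (show 0 ≤ z by omega)
  exact_mod_cast poch_neg_natCast_ne_zero (show k ≤ m by omega)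

/-- The kernel identity for integral parameters, with two independent sample sizes. -/
theorem sum_realHahn_mul_realHahn_natCast {d : ℕ} (ℓ : Fin (d + 1) → ℕ) {n : ℕ}
    (hn : ∀ i, n ≤ ℓ i) (X Y : Fin (d + 1) → ℝ) :
    ∑ ν ∈ piAntidiag (univ : Finset (Fin d)) n,
      realHahn (fun i => (ℓ i : ℝ)) (∑ i, X i) ν (fun i => X i.castSucc) *
      realHahn (fun i => (ℓ i : ℝ)) (∑ i, Y i) ν (fun i => Y i.castSucc) *
        realWeight (fun i => (ℓ i : ℝ)) ν =
    kernelConst (∑ i, (ℓ i : ℝ)) n * ∑ k ∈ range (n + 1), poch (-n) k *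
      poch (n - 1 - ∑ i, (ℓ i : ℝ)) k * poch (-(∑ i, X i) + k) (n - k) *
      poch (-(∑ i, Y i) + k) (n - k) * realE (fun i => (ℓ i : ℝ)) k X Y := by
  have cα : ∀ (ν : Fin d → ℕ) (j : Fin d),
      ContinuousAt (fun ε : ℝ => realAlpha (fun i => (ℓ i : ℝ) + ε) ν j) 0 := fun ν j => by
    unfold realAlpha
    fun_prop
  have cℓ : ∀ i, ContinuousAt (fun ε : ℝ => (ℓ i : ℝ) + ε) 0 := fun i => by fun_prop
  have cs : ContinuousAt (fun ε : ℝ => ∑ i, ((ℓ i : ℝ) + ε)) 0 := by fun_prop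
  have cQ : ∀ (Z : Fin (d + 1) → ℝ), ∀ ν ∈ piAntidiag (univ : Finset (Fin d)) n,
      ContinuousAt (fun ε : ℝ => realHahn (fun i => (ℓ i : ℝ) + ε) (∑ i, Z i) ν
        (fun i => Z i.castSucc)) 0 := fun Z ν hν => by
    have hν' : ∑ i, ν i = n := by simpa using hν
    unfold realHahn
    refine tendsto_finsetProd _ fun j _ => continuousAt_hahnCleared (cℓ _) (cα ν j) _ _ _ ?_
    intro k hk
    have := single_le_sum (f := ν) (fun i _ => Nat.zero_le _) (mem_univ j)
    rw [add_zero]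
    exact poch_neg_natCast_ne_zero (by have := hn j.castSucc; omega)
  have cW : ∀ ν ∈ piAntidiag (univ : Finset (Fin d)) n,
      ContinuousAt (fun ε : ℝ => realWeight (fun i => (ℓ i : ℝ) + ε) ν) 0 := fun ν hν => by
    have hν' : ∑ i, ν i = n := by simpa using hν
    unfold realWeight
    refine (continuousAt_poch cs.neg _).mul (tendsto_finsetProd _ fun j _ => ?_)
    have h1 := le_alpha ℓ hn hν' j
    have h2 := single_le_sum (f := ν) (fun i _ => Nat.zero_le _) (mem_univ j)
    have h3 := hn j.castSucc
    refine continuousAt_hahnWeight (cℓ _) (cα ν j) _ ?_ ?_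
    · simp only [add_zero, realAlpha_natCast]
      exact poch_neg_intCast_ne_zero h1
    · simp only [add_zero, realAlpha_natCast]
      -- Adding `ν_j ≤ ℓ_j` and `ν_j ≤ α_j` gives `2 ν_j ≤ ℓ_j + α_j + 1`, so no factor vanishes.
      have := poch_neg_intCast_ne_zero (z := ℓ j.castSucc + alpha ℓ ν j + 1) (k := 2 * ν j)
        (by push_cast; omega)
      push_cast at this
      rwa [show -(ℓ j.castSucc : ℝ) - alpha ℓ ν j - 1 = -((ℓ j.castSucc : ℝ) + alpha ℓ ν j + 1) by
        ring]
  have cE : ∀ k ∈ range (n + 1),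
      ContinuousAt (fun ε : ℝ => realE (fun i => (ℓ i : ℝ) + ε) k X Y) 0 := fun k hk => by
    unfold realE
    refine tendsto_finsetSum _ fun γ hγ => tendsto_finsetProd _ fun i _ => ?_
    have hγ' : ∑ i, γ i = k := by simpa using hγ
    have := single_le_sum (f := γ) (fun i _ => Nat.zero_le _) (mem_univ i)
    have hk' : k ≤ n := by simp at hk; omega
    refine ContinuousAt.div continuousAt_const
      ((continuousAt_poch (cℓ i).neg _).mul continuousAt_const) (mul_ne_zero ?_ (by positivity))
    simp only [add_zero]
    exact poch_neg_natCast_ne_zero (by have := hn i; omega)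
  have cK : ContinuousAt (fun ε : ℝ => kernelConst (∑ i, ((ℓ i : ℝ) + ε)) n) 0 := by
    unfold kernelConst
    have c1 : ContinuousAt (fun ε : ℝ => poch (-(∑ i, ((ℓ i : ℝ) + ε)) - 1) n) 0 :=
      continuousAt_poch (by fun_prop) n
    refine ((continuousAt_const.mul c1).mul (by fun_prop)).div (by fun_prop) ?_
    simp only [add_zero]
    positivity
  have cL : ContinuousAt (fun ε : ℝ => ∑ ν ∈ piAntidiag (univ : Finset (Fin d)) n,
      realHahn (fun i => (ℓ i : ℝ) + ε) (∑ i, X i) ν (fun i => X i.castSucc) *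
      realHahn (fun i => (ℓ i : ℝ) + ε) (∑ i, Y i) ν (fun i => Y i.castSucc) *
        realWeight (fun i => (ℓ i : ℝ) + ε) ν) 0 :=
    tendsto_finsetSum _ fun ν hν => ((cQ X ν hν).mul (cQ Y ν hν)).mul (cW ν hν)
  have cR : ContinuousAt (fun ε : ℝ => kernelConst (∑ i, ((ℓ i : ℝ) + ε)) n *
      ∑ k ∈ range (n + 1), poch (-n) k *
      poch (n - 1 - ∑ i, ((ℓ i : ℝ) + ε)) k * poch (-(∑ i, X i) + k) (n - k) *
      poch (-(∑ i, Y i) + k) (n - k) * realE (fun i => (ℓ i : ℝ) + ε) k X Y) 0 := by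
    refine cK.mul (tendsto_finsetSum _ fun k hk => ?_)
    have c1 : ContinuousAt (fun ε : ℝ => poch (n - 1 - ∑ i, ((ℓ i : ℝ) + ε)) k) 0 :=
      continuousAt_poch (by fun_prop) k
    exact (((continuousAt_const.mul c1).mul continuousAt_const).mul continuousAt_const).mul
      (cE k hk)
  -- The shifted parameters are generic only for small positive `ε`, hence the one-sided limit.
  have ev : ∀ᶠ ε : ℝ in nhdsWithin 0 (Set.Ioi 0), ε ∈ Set.Ioo (0 : ℝ) (1 / (d + 2)) :=
    Ioo_mem_nhdsGT (by positivity)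
  have h := tendsto_nhds_unique_of_eventuallyEq (cL.mono_left nhdsWithin_le_nhds)
    (cR.mono_left nhdsWithin_le_nhds) (ev.mono fun ε hε =>
      sum_realHahn_mul_realHahn _ (generic_natCast_add ℓ hε.1
        ((lt_div_iff₀ (by positivity)).mp hε.2)) X Y n)
  simpa only [add_zero] using h

/-! ### Return to the kernel on the polyhedron -/

theorem hahnMulti_eq_realHahn {d : ℕ} (ℓ : Fin (d + 1) → ℕ) (N : ℕ) (ν : Fin d → ℕ)
    (x : Fin d → ℝ) : hahnMulti ℓ N ν x = realHahn (fun i => (ℓ i : ℝ)) N ν x := by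
  simp only [hahnMulti, realHahn, realAlpha_natCast]

theorem homog_castSucc {d : ℕ} (N : ℕ) (x : Fin d → ℝ) (i : Fin d) :
    homog N x i.castSucc = x i := by
  simp [homog]

theorem sum_homog {d : ℕ} (N : ℕ) (x : Fin d → ℝ) : ∑ i, homog N x i = N := by
  rw [Fin.sum_univ_castSucc]
  simp [homog]

theorem elemE_eq_realE {d : ℕ} (ℓ : Fin (d + 1) → ℕ) (N : ℕ) {k : ℕ} (hk : ∀ i, k ≤ ℓ i)
    (x y : Fin d → ℝ) :
    elemE ℓ N k x y = realE (fun i => (ℓ i : ℝ)) k (homog N x) (homog N y) := by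
  rw [elemE, realE, filter_true_of_mem]
  · refine sum_congr rfl fun γ _ => ?_
    rw [prod_div_distrib, prod_mul_distrib, prod_mul_distrib]
  · intro γ hγ i
    have hγ' : ∑ i, γ i = k := by simpa using hγ
    have := single_le_sum (f := γ) (fun i _ => Nat.zero_le _) (mem_univ i)
    have := hk i
    omega

/-- Inversion distributes over products and quotients also at zero, by `0⁻¹ = 0`, so no factor has
to be nonzero. -/
theorem inv_hahnNormSq {d : ℕ} (ℓ : Fin (d + 1) → ℕ) (N : ℕ) (ν : Fin d → ℕ) :
    (hahnNormSq ℓ N ν)⁻¹ = (-1) ^ (∑ i, ν i) * poch (-(∑ i, ℓ i : ℕ)) N /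
      (poch (-N) (∑ i, ν i) * poch (-(∑ i, ℓ i : ℕ)) (N + ∑ i, ν i)) *
        realWeight (fun i => (ℓ i : ℝ)) ν := by
  have sg : ((-1 : ℝ) ^ (∑ i, ν i))⁻¹ = (-1) ^ (∑ i, ν i) := by
    rw [← inv_pow]; norm_num
  rw [hahnNormSq, realWeight, mul_inv, ← prod_inv_distrib]
  simp only [hahnWeight, inv_div, realAlpha_natCast]
  rw [div_eq_mul_inv _ ((-1) ^ _ * _ * _), mul_inv, mul_inv, sg]
  push_cast
  rw [div_eq_mul_inv _ (poch (-(N : ℝ)) _ * _), mul_inv]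
  ring

theorem mem_indexSet_of_sum_eq {d : ℕ} {N : ℕ} {ℓ : Fin (d + 1) → ℕ} {n : ℕ} (hnN : n ≤ N)
    (hsum : N + n ≤ ∑ i, ℓ i) (hn : ∀ i, n ≤ ℓ i) {ν : Fin d → ℕ} (hν : ∑ i, ν i = n) :
    ν ∈ indexSet ℓ N := by
  refine ⟨by omega, by omega, fun j => ⟨?_, le_alpha ℓ hn hν j⟩⟩
  have := single_le_sum (f := ν) (fun i _ => Nat.zero_le _) (mem_univ j)
  have := hn j.castSucc
  omega

/-- Two parameters already sum to at least `N`, and a third contributes at least `n`. -/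
theorem add_le_sum_parameters {d : ℕ} (hd : 2 ≤ d) {N : ℕ} {ℓ : Fin (d + 1) → ℕ}
    (hadd : ∀ i j, i ≠ j → N ≤ ℓ i + ℓ j) {n : ℕ} (hn : ∀ i, n ≤ ℓ i) :
    N + n ≤ ∑ i, ℓ i := by
  obtain ⟨e, rfl⟩ := Nat.exists_eq_add_of_le' hd
  rw [Fin.sum_univ_succ, Fin.sum_univ_succ, Fin.sum_univ_succ]
  have h1 := hadd 0 (Fin.succ 0) (Fin.succ_ne_zero 0).symm
  have h2 := hn (Fin.succ (Fin.succ 0))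
  omega

theorem kernelConst_eq (L : ℝ) (n : ℕ) (h1 : L + 1 ≠ 0) (h2 : L + 1 - n ≠ 0) :
    kernelConst L n = (-1) ^ n * poch (-L) n * (L + 1 - 2 * n) /
      ((n.factorial : ℝ) * (L + 1 - n)) := by
  have s := poch_succ_left (-L - 1) n
  rw [poch_succ, sub_add_cancel] at s
  have f : (n.factorial : ℝ) ≠ 0 := by positivity
  rw [kernelConst, div_eq_div_iff (mul_ne_zero f h1) (mul_ne_zero f h2)]
  linear_combination (-(-1) ^ n * (L + 1 - 2 * n) * (n.factorial : ℝ)) * s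

end HahnPolyhedra

open HahnPolyhedra in
/-- The hypothesis `hd1` is needed only in one variable, where for `n > ℓ₁ + ℓ₂ - N` the factor
`(-|ℓ|)_{N+n}` in the denominator is zero; for `d ≥ 2` it is nonzero for all `n ≤ ℓ_min`. -/
theorem proposition5p3 (d : ℕ) (hd : 1 ≤ d) (N : ℕ) (ℓ : Fin (d + 1) → ℕ)
    (hle : ∀ i, ℓ i ≤ N) (hadd : ∀ i j, i ≠ j → N ≤ ℓ i + ℓ j)
    (x y : Fin d → ℕ) (hx : x ∈ polyhedron ℓ N) (hy : y ∈ polyhedron ℓ N)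
    (n : ℕ) (hn : n ≤ ellMin ℓ) (hd1 : d = 1 → N + n ≤ ∑ i, ℓ i) :
    kernel ℓ N n (fun i => (x i : ℝ)) (fun i => (y i : ℝ)) =
      poch (-N) n * poch (-(∑ i, ℓ i : ℕ)) N * poch (-(∑ i, ℓ i : ℕ)) n
          * (((∑ i, ℓ i : ℕ) : ℝ) + 1 - 2 * n)
        / ((n.factorial : ℝ) * poch (-(∑ i, ℓ i : ℕ)) (N + n)
          * (((∑ i, ℓ i : ℕ) : ℝ) + 1 - n))
      * ∑ k ∈ Finset.range (n + 1),
          poch (-n) k * poch (n - 1 - (∑ i, ℓ i : ℕ)) k / (poch (-N) k * poch (-N) k)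
            * elemE ℓ N k (fun i => (x i : ℝ)) (fun i => (y i : ℝ)) := by
  have hn' : ∀ i, n ≤ ℓ i := fun i => hn.trans (Finset.inf'_le ℓ (Finset.mem_univ i))
  have hnN : n ≤ N := (hn' 0).trans (hle 0)
  have hsum : N + n ≤ ∑ i, ℓ i := by
    rcases Nat.lt_or_ge d 2 with h | h
    · exact hd1 (by omega)
    · exact add_le_sum_parameters h hadd hn'
  have main := sum_realHahn_mul_realHahn_natCast ℓ hn' (homog N fun i => (x i : ℝ))
    (homog N fun i => (y i : ℝ))
  simp only [homog_castSucc, sum_homog, ← Nat.cast_sum] at main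
  have hL1 : ((∑ i, ℓ i : ℕ) : ℝ) + 1 ≠ 0 := by positivity
  have hL2 : ((∑ i, ℓ i : ℕ) : ℝ) + 1 - n ≠ 0 := by
    have : (n : ℝ) ≤ (∑ i, ℓ i : ℕ) := by exact_mod_cast (by omega)
    intro h
    linarith
  rw [kernelConst_eq _ _ hL1 hL2] at main
  have hN : poch (-N : ℝ) n ≠ 0 := poch_neg_natCast_ne_zero hnN
  have sg : (-1 : ℝ) ^ n * (-1) ^ n = 1 := by rw [← mul_pow]; simp
  have hmem : ∀ ν ∈ Finset.piAntidiag (Finset.univ : Finset (Fin d)) n, ν ∈ indexSet ℓ N :=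
    fun ν hν => mem_indexSet_of_sum_eq hnN hsum hn' (by simpa using hν)
  classical
  rw [kernel, Finset.filter_true_of_mem hmem]
  have hk : ∀ ν ∈ Finset.piAntidiag (Finset.univ : Finset (Fin d)) n,
      hahnMulti ℓ N ν (fun i => (x i : ℝ)) * hahnMulti ℓ N ν (fun i => (y i : ℝ)) /
        hahnNormSq ℓ N ν = (-1) ^ n * poch (-(∑ i, ℓ i : ℕ)) N /
        (poch (-N) n * poch (-(∑ i, ℓ i : ℕ)) (N + n)) *
        (realHahn (fun i => (ℓ i : ℝ)) N ν (fun i => (x i : ℝ)) *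
          realHahn (fun i => (ℓ i : ℝ)) N ν (fun i => (y i : ℝ)) *
          realWeight (fun i => (ℓ i : ℝ)) ν) := by
    intro ν hν
    have hν' : ∑ i, ν i = n := by simpa using hν
    rw [div_eq_mul_inv, inv_hahnNormSq, hν', hahnMulti_eq_realHahn, hahnMulti_eq_realHahn]
    ring
  rw [Finset.sum_congr rfl hk, ← Finset.mul_sum, main, ← mul_assoc, Finset.mul_sum, Finset.mul_sum]
  refine Finset.sum_congr rfl fun k hk => ?_
  have hkn : k ≤ n := by simp at hk; omega
  rw [elemE_eq_realE ℓ N (fun i => hkn.trans (hn' i))]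
  have hs := poch_split (-N : ℝ) hkn
  have hNk : poch (-N : ℝ) k ≠ 0 := fun h => hN (by rw [hs, h, zero_mul])
  -- The two sample sizes now agree, so this quotient enters squared; one factor `(-N)_n` cancels
  -- against the norm, and the other is the one in the prefactor.
  have hq : poch (-(N : ℝ) + k) (n - k) = poch (-N) n / poch (-N) k := by
    rw [hs, mul_div_cancel_left₀ _ hNk]
  rw [hq]
  generalize realE (fun i => (ℓ i : ℝ)) k (homog N fun i => (x i : ℝ))
    (homog N fun i => (y i : ℝ)) = v1
  generalize poch (-N : ℝ) n = v2 at *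
  generalize poch (-N : ℝ) k = v3 at *
  have hP := poch_neg_natCast_ne_zero hsum
  have hf : (n.factorial : ℝ) ≠ 0 := by positivity
  generalize poch (-((∑ i, ℓ i : ℕ) : ℝ)) (N + n) = v4 at *
  generalize ((∑ i, ℓ i : ℕ) : ℝ) + 1 - n = v5 at *
  field_simp
  rw [pow_two, sg, one_mul]
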